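/- **Setting.** Units $8\pi G=c=1$. A spherically symmetric perfect fluid cloud is described in comoving coordinates by $ds^2=-e^{2\nu}dt^2+e^{2\psi}dr^2+R^2(d\theta^2+\sin^2\theta\,d\varphi^2)$ with $\nu,\psi,R$ functions of $(t,r)$, smooth on $\mathcal D=\{t_0<t<t_s(r),\ 0\le r<r_b\}$, and $G_{ab}=\mu u_au_b+p(g_{ab}+u_au_b)$ holds with $u=e^{-\nu}\partial_t$ and $\mu,p$ continuous on $\mathcal D$. Put $e=e^{-\psi}\partial_r$. *Continued collapse* means: the centre is regular ($R=0$ and $\partial_rR=e^{\psi}$ at $r=0$), there are no shell crossings ($\partial_rR>0$ for $r>0$), every shell contracts ($\partial_tR<0$ for $r>0$), the shell $r>0$ reaches $R\to0$ as $t\to t_s(r)$, where $t_s$ is continuous and non-decreasing with $t_s(0)>t_0$, and $\mu(t,0)\to\infty$ as $t\to t_s(0)$. The *central singularity* is $(t,r)=(t_s(0),0)$. Let $\Theta$ and $\sigma_{ab}$ be the expansion and shear of $u$, $\Sigma=\sigma_{ab}e^ae^b$, $N^{ab}=g^{ab}+u^au^b-e^ae^b$, $\phi=N^{ab}\nabla_ae_b$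 and $\Psi=\frac23\Theta-\Sigma+\phi$. Let $\tilde\Theta_{\rm out}=N^{ab}\nabla_bk_a$ and $\tilde\Theta_{\rm in}=N^{ab}\nabla_bl_a$ with $k=(u+e)/\sqrt2$ and $l=(u-e)/\sqrt2$. The *apparent horizon* is the set of points with $r>0$ and $\tilde\Theta_{\rm out}=0$; a 2-sphere is *trapped* if $\tilde\Theta_{\rm out}<0$ and $\tilde\Theta_{\rm in}<0$ on it. A *horizon tangent* at a point of the apparent horizon is a vector $\Psi^a=\alpha u^a+\beta e^a\neq0$ with $\Psi^a\nabla_a\Psi=0$; it is *ingoing* if $\alpha/\beta<0$. The central singularity is *locally naked* if, for some $r_1\in(0,r_b)$, there are future-directed outgoing radial null geodesics that start arbitrarily close to it and reach the shell $r_1$ with $\tilde\Theta_{\rm out}\ge0$ all along. The end state is a *black hole* if every shell $r\in(0,r_b)$ is trapped from some time $t_1<t_s(0)$ on (as long as it is regular) and the central singularity is not locally naked. **Corollary (conformally flat collapse gives a black hole).** Consider the continued collapse of a spherically symmetric perfect fluid obeying the strong energy condition $\mu\ge0$, $\mu+3p\ge0$ in a conformally flat spacetime (vanishing Weyl tensor,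 so ${\cal E}=0$). 1. If the apparent horizon reaches the central singularity (every neighbourhood of it contains points of the apparent horizon), then the end state is a black hole. 2. At every point of the apparent horizon $\Psi=0$ and $\mu+p>0$, horizon tangents exist, and every horizon tangent $\alpha u+\beta e$ satisfies: - $\alpha\left(\frac13\mu+p\right)=-\frac23\mu\,\beta$, and $\beta=0$ exactly when $\mu+3p=0$. If $\beta\ne0$ then $\dfrac{\alpha}{\beta}=\dfrac{-\frac23\mu}{\frac13\mu+p}$. - $\alpha/\beta\ge1$ never holds: it would force $\mu+p\le0$. If $\beta\neq0$ then $\alpha/\beta<0$, so the tangent is ingoing. - $\Psi^a\Psi_a$ is a positive multiple of $-\frac13(\mu+p)(\mu-3p)$. The tangent is timelike, null or spacelike if and only if $\mu>3p$, $\mu=3p$ or $\mu<3p$, respectively. -/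

import Mathlib

open Set Filter Topology
open scoped ContDiff

noncomputable section

/-! ## Tensor calculus in a four-dimensional chart -/

/-- Coordinates `(t, r, θ, φ)`, numbered `0, 1, 2, 3`. -/
abbrev Coord := Fin 4 → ℝ

/-- A (covariant) metric in the chart. -/
abbrev ChartMetric := Coord → Matrix (Fin 4) (Fin 4) ℝ

/-- The partial derivative `∂_a f` at `x`. -/
def partialD (a : Fin 4) (f : Coord → ℝ) (x : Coord) : ℝ :=
  deriv (fun s : ℝ => f (Function.update x a s)) (x a)

/-- Christoffel symbol `Γ^a_{bc}`. -/
def christoffel (g : ChartMetric) (a b c : Fin 4) (x : Coord) : ℝ :=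
  (1 / 2) * ∑ d, (g x)⁻¹ a d *
    (partialD b (fun y => g y d c) x + partialD c (fun y => g y d b) x
      - partialD d (fun y => g y b c) x)

/-- Riemann tensor `R^a_{bcd} = ∂_c Γ^a_{db} - ∂_d Γ^a_{cb} + Γ^a_{ce} Γ^e_{db} - Γ^a_{de} Γ^e_{cb}`. -/
def riemann (g : ChartMetric) (a b c d : Fin 4) (x : Coord) : ℝ :=
  partialD c (christoffel g a d b) x - partialD d (christoffel g a c b) x
    + ∑ e, (christoffel g a c e x * christoffel g e d b x
      - christoffel g a d e x * christoffel g e c b x)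

/-- Riemann tensor with all indices down, `R_{abcd}`. -/
def riemannDown (g : ChartMetric) (a b c d : Fin 4) (x : Coord) : ℝ :=
  ∑ e, g x a e * riemann g e b c d x

/-- Ricci tensor `R_{bd} = R^a_{bad}`. -/
def ricci (g : ChartMetric) (b d : Fin 4) (x : Coord) : ℝ :=
  ∑ a, riemann g a b a d x

/-- Scalar curvature. -/
def scalarCurv (g : ChartMetric) (x : Coord) : ℝ :=
  ∑ a, ∑ b, (g x)⁻¹ a b * ricci g a b x

/-- Einstein tensor `G_{ab} = R_{ab} - (1/2) R g_{ab}`. -/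
def einstein (g : ChartMetric) (a b : Fin 4) (x : Coord) : ℝ :=
  ricci g a b x - (1 / 2) * scalarCurv g x * g x a b

/-- Weyl tensor `C_{abcd}` in dimension four. -/
def weyl (g : ChartMetric) (a b c d : Fin 4) (x : Coord) : ℝ :=
  riemannDown g a b c d x
    - (1 / 2) * (g x a c * ricci g b d x - g x a d * ricci g b c x
        - g x b c * ricci g a d x + g x b d * ricci g a c x)
    + (1 / 6) * scalarCurv g x * (g x a c * g x b d - g x a d * g x b c)

/-- Lowering the index of a vector field. -/
def lower (g : ChartMetric) (V : Coord → Fin 4 → ℝ) (a : Fin 4) (x : Coord) : ℝ :=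
  ∑ b, g x a b * V x b

/-- `∇_a V_b` for a vector field `V`. -/
def covD (g : ChartMetric) (V : Coord → Fin 4 → ℝ) (a b : Fin 4) (x : Coord) : ℝ :=
  partialD a (lower g V b) x - ∑ c, christoffel g c a b x * lower g V c x

/-- The scalar product `g(v, w)` of two vectors at `x`. -/
def innerG (g : ChartMetric) (x : Coord) (v w : Fin 4 → ℝ) : ℝ :=
  ∑ a, ∑ b, g x a b * v a * w b

/-- The derivative of the scalar `f` in the direction of the vector `v` at `x`. -/
def dirD (v : Fin 4 → ℝ) (f : Coord → ℝ) (x : Coord) : ℝ :=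
  ∑ a, v a * partialD a f x

/-! ## A spherically symmetric fluid cloud in comoving coordinates -/

/-- The data of a spherically symmetric fluid cloud: the metric
`ds² = - e^{2ν} dt² + e^{2ψ} dr² + R² (dθ² + sin² θ dφ²)` in comoving coordinates, with `ν, ψ, R`
functions of `(t, r)`; the energy density `μ` and the pressure `p`; the initial time `t0`,
the comoving radius `rb` of the boundary, and the time `ts r` at which the shell `r`
becomes singular. -/
structure FluidCloud where
  ν : ℝ → ℝ → ℝ
  ψ : ℝ → ℝ → ℝ
  R : ℝ → ℝ → ℝ
  μ : ℝ → ℝ → ℝ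
  p : ℝ → ℝ → ℝ
  t0 : ℝ
  rb : ℝ
  ts : ℝ → ℝ

namespace FluidCloud

variable (C : FluidCloud)

/-- The part of the `(t, r)` half plane occupied by the cloud before its shells become
singular, the centre `r = 0` included. -/
def domain : Set (ℝ × ℝ) :=
  {q | C.t0 < q.1 ∧ q.1 < C.ts q.2 ∧ 0 ≤ q.2 ∧ q.2 < C.rb}

/-- The points of the chart: off the centre and off the axis of the polar angles. -/
def region : Set Coord :=
  {x | (x 0, x 1) ∈ C.domain ∧ 0 < x 1 ∧ 0 < x 2 ∧ x 2 < Real.pi}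

/-- The spacetime metric. -/
def metric : ChartMetric := fun x =>
  Matrix.diagonal ![-Real.exp (2 * C.ν (x 0) (x 1)), Real.exp (2 * C.ψ (x 0) (x 1)),
    C.R (x 0) (x 1) ^ 2, C.R (x 0) (x 1) ^ 2 * Real.sin (x 2) ^ 2]

/-- The four-velocity `u^a` of the fluid. -/
def u (x : Coord) : Fin 4 → ℝ := ![Real.exp (-C.ν (x 0) (x 1)), 0, 0, 0]

/-- The unit radial vector `e^a`. -/
def e (x : Coord) : Fin 4 → ℝ := ![0, Real.exp (-C.ψ (x 0) (x 1)), 0, 0]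

/-- `h_{ab} = g_{ab} + u_a u_b`. -/
def hDown (a b : Fin 4) (x : Coord) : ℝ :=
  C.metric x a b + lower C.metric C.u a x * lower C.metric C.u b x

/-- `h^{ab} = g^{ab} + u^a u^b`. -/
def hUp (a b : Fin 4) (x : Coord) : ℝ :=
  (C.metric x)⁻¹ a b + C.u x a * C.u x b

/-- `h^a_b = δ^a_b + u^a u_b`. -/
def hMixed (a b : Fin 4) (x : Coord) : ℝ :=
  (if a = b then 1 else 0) + C.u x a * lower C.metric C.u b x

/-- The projector onto the 2-spheres, `N^{ab} = g^{ab} + u^a u^b - e^a e^b`. -/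
def nUp (a b : Fin 4) (x : Coord) : ℝ :=
  (C.metric x)⁻¹ a b + C.u x a * C.u x b - C.e x a * C.e x b

/-- The expansion `Θ = D_a u^a` of the fluid. -/
def expansion (x : Coord) : ℝ :=
  ∑ a, ∑ b, C.hUp a b x * covD C.metric C.u a b x

/-- The shear tensor `σ_{ab}` of the fluid: the projected symmetric trace-free part of
`∇_a u_b`. -/
def shear (a b : Fin 4) (x : Coord) : ℝ :=
  (∑ c, ∑ d, C.hMixed c a x * C.hMixed d b x *
      ((1 / 2) * (covD C.metric C.u c d x + covD C.metric C.u d c x)))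
    - (1 / 3) * C.expansion x * C.hDown a b x

/-- The shear scalar `Σ = σ_{ab} e^a e^b`. -/
def shearScalar (x : Coord) : ℝ :=
  ∑ a, ∑ b, C.shear a b x * C.e x a * C.e x b

/-- The expansion `φ = N^{ab} ∇_a e_b` of the 2-spheres along `e^a`. -/
def sheetExpansion (x : Coord) : ℝ :=
  ∑ a, ∑ b, C.nUp a b x * covD C.metric C.e a b x

/-- The scalar `Ψ = (2/3) Θ - Σ + φ`. -/
def Psi (x : Coord) : ℝ :=
  (2 / 3) * C.expansion x - C.shearScalar x + C.sheetExpansion x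

/-- The outgoing radial null vector `k = (u + e) / √2`. -/
def kOut (x : Coord) : Fin 4 → ℝ := (1 / Real.sqrt 2) • (C.u x + C.e x)

/-- The ingoing radial null vector `l = (u - e) / √2`. -/
def lIn (x : Coord) : Fin 4 → ℝ := (1 / Real.sqrt 2) • (C.u x - C.e x)

/-- The expansion `N^{ab} ∇_b k_a` of the outgoing null congruence. -/
def thetaOut (x : Coord) : ℝ :=
  ∑ a, ∑ b, C.nUp a b x * covD C.metric C.kOut b a x

/-- The expansion `N^{ab} ∇_b l_a` of the ingoing null congruence. -/
def thetaIn (x : Coord) : ℝ :=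
  ∑ a, ∑ b, C.nUp a b x * covD C.metric C.lIn b a x

/-- The metric solves Einstein's equations `G_{ab} = T_{ab}` (units `8πG = c = 1`) with the
perfect fluid source `T_{ab} = μ u_a u_b + p h_{ab}`. -/
def IsPerfectFluid : Prop :=
  ∀ x ∈ C.region, ∀ a b : Fin 4,
    einstein C.metric a b x =
      C.μ (x 0) (x 1) * lower C.metric C.u a x * lower C.metric C.u b x
        + C.p (x 0) (x 1) * C.hDown a b x

/-- Continued collapse of a perfect fluid cloud, regular until the shell `r` becomes singular
at the time `ts r`, without shell crossings, the central shell being the first to become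
singular. -/
structure IsContinuedCollapse : Prop where
  rb_pos : 0 < C.rb
  t0_lt : C.t0 < C.ts 0
  ts_continuous : ContinuousOn C.ts (Ico 0 C.rb)
  ts_monotone : MonotoneOn C.ts (Ico 0 C.rb)
  ν_smooth : ContDiffOn ℝ ∞ (fun q : ℝ × ℝ => C.ν q.1 q.2) C.domain
  ψ_smooth : ContDiffOn ℝ ∞ (fun q : ℝ × ℝ => C.ψ q.1 q.2) C.domain
  R_smooth : ContDiffOn ℝ ∞ (fun q : ℝ × ℝ => C.R q.1 q.2) C.domain
  μ_continuous : ContinuousOn (fun q : ℝ × ℝ => C.μ q.1 q.2) C.domain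
  p_continuous : ContinuousOn (fun q : ℝ × ℝ => C.p q.1 q.2) C.domain
  /-- The centre is regular. -/
  R_centre : ∀ t, (t, (0 : ℝ)) ∈ C.domain → C.R t 0 = 0
  /-- There is no conical singularity at the centre. -/
  R_centre_deriv : ∀ t, (t, (0 : ℝ)) ∈ C.domain →
    HasDerivWithinAt (fun r => C.R t r) (Real.exp (C.ψ t 0)) (Ici 0) 0
  /-- There are no shell crossings. -/
  no_shell_crossing : ∀ t r, (t, r) ∈ C.domain → 0 < r → 0 < deriv (fun s => C.R t s) r
  /-- Every shell is collapsing. -/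
  collapsing : ∀ t r, (t, r) ∈ C.domain → 0 < r → deriv (fun s => C.R s r) t < 0
  /-- Every shell collapses to zero area radius. -/
  shell_focusing : ∀ r ∈ Ioo 0 C.rb, Tendsto (fun t => C.R t r) (𝓝[<] (C.ts r)) (𝓝 0)
  /-- The density at the centre diverges at the central singularity. -/
  central_singularity : Tendsto (fun t => C.μ t 0) (𝓝[<] (C.ts 0)) atTop
  perfect_fluid : C.IsPerfectFluid

/-- The strong energy condition. -/
def StrongEnergyCondition : Prop :=
  ∀ t r, (t, r) ∈ C.domain → 0 ≤ C.μ t r ∧ 0 ≤ C.μ t r + 3 * C.p t r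

/-- Conformal flatness: the Weyl tensor vanishes. -/
def IsConformallyFlat : Prop :=
  ∀ x ∈ C.region, ∀ a b c d : Fin 4, weyl C.metric a b c d x = 0

/-- The apparent horizon: the points where the outgoing null expansion vanishes. -/
def apparentHorizon : Set Coord := {x | x ∈ C.region ∧ C.thetaOut x = 0}

/-- The apparent horizon reaches the central singularity `(t, r) = (ts 0, 0)`. -/
def HorizonReachesCentralSingularity : Prop :=
  ∀ ε > 0, ∃ x ∈ C.apparentHorizon, |x 0 - C.ts 0| < ε ∧ x 1 < ε

/-- The 2-sphere through `x` is a closed trapped surface. -/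
def IsTrapped (x : Coord) : Prop := C.thetaOut x < 0 ∧ C.thetaIn x < 0

/-- `γ : [0, 1] → M` is a future-directed outgoing radial null ray of the cloud (a null geodesic
up to parametrization), possibly starting at the centre. -/
def IsOutgoingNullRay (γ : ℝ → Coord) : Prop :=
  ContinuousOn γ (Icc 0 1) ∧
  (γ 0 0, γ 0 1) ∈ C.domain ∧
  (∀ s ∈ Ioc (0 : ℝ) 1, γ s ∈ C.region) ∧
  ∃ κ : ℝ → ℝ, ∀ s ∈ Ioo (0 : ℝ) 1, 0 < κ s ∧ HasDerivAt γ (κ s • C.kOut (γ s)) s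

/-- The central singularity is locally naked: for some shell `r₁ > 0`, outgoing null rays
starting arbitrarily close to the central singularity escape to that shell without getting
trapped. -/
def IsLocallyNaked : Prop :=
  ∃ r₁ ∈ Ioo 0 C.rb, ∀ ε > 0, ∃ γ : ℝ → Coord, C.IsOutgoingNullRay γ ∧
    |γ 0 0 - C.ts 0| < ε ∧ γ 0 1 < ε ∧ γ 1 1 = r₁ ∧
    ∀ s ∈ Ioc (0 : ℝ) 1, 0 ≤ C.thetaOut (γ s)

/-- The end state of the collapse is a black hole: every shell is trapped from some time before
the central singularity on (so the region around the centre gets trapped before the central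
singularity), and the central singularity is not locally naked. -/
def EndStateIsBlackHole : Prop :=
  (∀ r ∈ Ioo 0 C.rb, ∃ t₁, C.t0 < t₁ ∧ t₁ < C.ts 0 ∧
    ∀ x ∈ C.region, x 1 = r → t₁ ≤ x 0 → C.IsTrapped x) ∧
  ¬ C.IsLocallyNaked

/-- The vector `α u + β e` at `x`. -/
def planeVec (α β : ℝ) (x : Coord) : Fin 4 → ℝ := α • C.u x + β • C.e x

/-- `α u + β e` is a (nonzero) tangent vector at `x` to the curve `Ψ = 0` in the `[u, e]`
plane. -/
def IsHorizonTangent (α β : ℝ) (x : Coord) : Prop :=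
  (α ≠ 0 ∨ β ≠ 0) ∧ dirD (C.planeVec α β x) C.Psi x = 0

end FluidCloud

end

/-! Write `U = u^a ∂_a R` (`areaRate`) and `S = e^a ∂_a R` (`areaSlope`). Then `Ψ = 2(U + S)/R` and
`Ψ = √2 · thetaOut`, while contraction and the absence of shell crossings give `U < 0 < S`.

With zero Weyl tensor the Riemann tensor is algebraic in the metric, `μ` and `p`. The component
tangent to the spheres gives `1 + U² - S² = μR²/3`, and the mixed ones give the first derivatives of
`U` and `S`. Hence a sphere lies on the horizon only if its compactness `μR²/3` equals `1`
(`compactness_eq_one`), and it is trapped once this exceeds `1` (`isTrapped_of_one_lt`).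

Differentiating the constraint gives two facts. Radially, `μ` does not depend on `r`, so a
divergence of the central density makes all shells singular together (`hasDerivAt_density_radial`,
`ts_eq_centre`). In time, the strong energy condition makes the compactness of each shell
non-decreasing (`compactness_le`). If the horizon meets some shell inside `r`, then at that time the
shell `r` has the same density and a larger area radius, so its compactness exceeds `1` and stays so
(`exists_trapped_after`). A null ray that starts late enough reaches its final shell after that
shell is trapped, which excludes local nakedness.

At the horizon `U + S = 0` removes every connection term from the derivative of `Ψ`, leaving a
linear equation in `α, β` with coefficients in `μ, p` (`dirD_Psi`). The second part is algebra on
that equation with `μ > 0` and `μ + 3p ≥ 0`. -/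

noncomputable section

/-- The partial derivative in the first variable of a function of `(t, r)`. -/
def timeDeriv (f : ℝ → ℝ → ℝ) (t r : ℝ) : ℝ := deriv (fun s => f s r) t

/-- The partial derivative in the second variable of a function of `(t, r)`. -/
def radialDeriv (f : ℝ → ℝ → ℝ) (t r : ℝ) : ℝ := deriv (fun s => f t s) r

/-! ### Partial derivatives of smooth functions of `(t, r)` -/

section Smooth

variable {f : ℝ → ℝ → ℝ} {S : Set (ℝ × ℝ)}

lemma timeDeriv_eq_fderiv {t r : ℝ}
    (hf : DifferentiableAt ℝ (fun q : ℝ × ℝ => f q.1 q.2) (t, r)) :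
    HasDerivAt (fun s => f s r) (fderiv ℝ (fun q : ℝ × ℝ => f q.1 q.2) (t, r) (1, 0)) t := by
  have h : HasDerivAt (fun s : ℝ => (s, r)) ((1 : ℝ), (0 : ℝ)) t :=
    (hasDerivAt_id t).prodMk (hasDerivAt_const t r)
  exact hf.hasFDerivAt.comp_hasDerivAt t h

lemma radialDeriv_eq_fderiv {t r : ℝ}
    (hf : DifferentiableAt ℝ (fun q : ℝ × ℝ => f q.1 q.2) (t, r)) :
    HasDerivAt (fun s => f t s) (fderiv ℝ (fun q : ℝ × ℝ => f q.1 q.2) (t, r) (0, 1)) r := by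
  have h : HasDerivAt (fun s : ℝ => (t, s)) ((0 : ℝ), (1 : ℝ)) r :=
    (hasDerivAt_const r t).prodMk (hasDerivAt_id r)
  exact hf.hasFDerivAt.comp_hasDerivAt r h

lemma ContDiffOn.differentiableAt_of_isOpen (hS : IsOpen S)
    (hf : ContDiffOn ℝ ∞ (fun q : ℝ × ℝ => f q.1 q.2) S) {q : ℝ × ℝ} (hq : q ∈ S) :
    DifferentiableAt ℝ (fun q : ℝ × ℝ => f q.1 q.2) q :=
  (hf.contDiffAt (hS.mem_nhds hq)).differentiableAt (by simp)

lemma hasDerivAt_timeDeriv (hS : IsOpen S)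
    (hf : ContDiffOn ℝ ∞ (fun q : ℝ × ℝ => f q.1 q.2) S) {t r : ℝ} (hq : (t, r) ∈ S) :
    HasDerivAt (fun s => f s r) (timeDeriv f t r) t :=
  (timeDeriv_eq_fderiv (hf.differentiableAt_of_isOpen hS hq)).differentiableAt.hasDerivAt

lemma hasDerivAt_radialDeriv (hS : IsOpen S)
    (hf : ContDiffOn ℝ ∞ (fun q : ℝ × ℝ => f q.1 q.2) S) {t r : ℝ} (hq : (t, r) ∈ S) :
    HasDerivAt (fun s => f t s) (radialDeriv f t r) r :=
  (radialDeriv_eq_fderiv (hf.differentiableAt_of_isOpen hS hq)).differentiableAt.hasDerivAt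

lemma contDiffOn_timeDeriv (hS : IsOpen S)
    (hf : ContDiffOn ℝ ∞ (fun q : ℝ × ℝ => f q.1 q.2) S) :
    ContDiffOn ℝ ∞ (fun q : ℝ × ℝ => timeDeriv f q.1 q.2) S := by
  refine ContDiffOn.congr (f := fun q => fderiv ℝ (fun q : ℝ × ℝ => f q.1 q.2) q (1, 0))
    ((hf.fderiv_of_isOpen hS (m := ∞) (by simp)).clm_apply contDiffOn_const) fun q hq => ?_
  exact (timeDeriv_eq_fderiv (hf.differentiableAt_of_isOpen hS hq)).deriv

lemma contDiffOn_radialDeriv (hS : IsOpen S)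
    (hf : ContDiffOn ℝ ∞ (fun q : ℝ × ℝ => f q.1 q.2) S) :
    ContDiffOn ℝ ∞ (fun q : ℝ × ℝ => radialDeriv f q.1 q.2) S := by
  refine ContDiffOn.congr (f := fun q => fderiv ℝ (fun q : ℝ × ℝ => f q.1 q.2) q (0, 1))
    ((hf.fderiv_of_isOpen hS (m := ∞) (by simp)).clm_apply contDiffOn_const) fun q hq => ?_
  exact (radialDeriv_eq_fderiv (hf.differentiableAt_of_isOpen hS hq)).deriv

end Smooth

/-! ### Regularity of the cloud off the centre -/

namespace FluidCloud

variable (C : FluidCloud)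

/-- The part of the `(t, r)` domain off the centre. -/
def offCentre : Set (ℝ × ℝ) := {q | q ∈ C.domain ∧ 0 < q.2}

variable {C}

lemma offCentre_subset : C.offCentre ⊆ C.domain := fun _ h => h.1

/-- Continuity of `ts` keeps `t < ts r` an open condition. Removing the boundary `r = 0` leaves an
open set, where two-sided partial derivatives are available. -/
lemma IsContinuedCollapse.isOpen_offCentre (hC : C.IsContinuedCollapse) :
    IsOpen C.offCentre := by
  rw [isOpen_iff_mem_nhds]
  rintro ⟨t, r⟩ ⟨⟨h1, h2, h3, h4⟩, h5⟩
  simp only at h1 h2 h3 h4 h5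
  have hts : ContinuousAt C.ts r :=
    hC.ts_continuous.continuousAt (Ico_mem_nhds h5 h4)
  have hc : ContinuousAt (fun q : ℝ × ℝ => C.ts q.2) (t, r) :=
    ContinuousAt.comp (f := Prod.snd) (x := (t, r)) hts continuousAt_snd
  filter_upwards [continuousAt_const.eventually_lt (continuousAt_fst (p := (t, r))) h1,
    (continuousAt_fst (p := (t, r))).eventually_lt hc h2,
    continuousAt_const.eventually_lt (continuousAt_snd (p := (t, r))) h5,
    (continuousAt_snd (p := (t, r))).eventually_lt continuousAt_const h4] with q a b c d
  exact ⟨⟨a, b, c.le, d⟩, c⟩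

lemma mem_offCentre {x : Coord} (hx : x ∈ C.region) : (x 0, x 1) ∈ C.offCentre :=
  ⟨hx.1, hx.2.1⟩

lemma IsContinuedCollapse.R_strictAntiOn (hC : C.IsContinuedCollapse) {t r : ℝ}
    (h : (t, r) ∈ C.offCentre) : StrictAntiOn (fun s => C.R s r) (Ico t (C.ts r)) := by
  obtain ⟨⟨h1, h2, h3, h4⟩, h5⟩ := h
  simp only at h1 h2 h3 h4 h5
  have hmem : ∀ s ∈ Ico t (C.ts r), (s, r) ∈ C.offCentre := fun s hs =>
    ⟨⟨h1.trans_le hs.1, hs.2, h3, h4⟩, h5⟩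
  have hd : ∀ s ∈ Ico t (C.ts r), HasDerivAt (fun s => C.R s r) (timeDeriv C.R s r) s :=
    fun s hs => hasDerivAt_timeDeriv hC.isOpen_offCentre (hC.R_smooth.mono offCentre_subset)
      (hmem s hs)
  refine strictAntiOn_of_deriv_neg (convex_Ico _ _)
    (fun s hs => (hd s hs).continuousAt.continuousWithinAt) fun s hs => ?_
  rw [interior_Ico] at hs
  exact hC.collapsing s r (hmem s (Ioo_subset_Ico_self hs)).1 h5

/-- A strictly decreasing function of time that tends to `0` is positive before its limit. -/
lemma IsContinuedCollapse.R_pos (hC : C.IsContinuedCollapse) {t r : ℝ}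
    (h : (t, r) ∈ C.offCentre) : 0 < C.R t r := by
  have hanti := hC.R_strictAntiOn h
  obtain ⟨⟨h1, h2, h3, h4⟩, h5⟩ := h
  simp only at h1 h2 h3 h4 h5
  obtain ⟨m, hm1, hm2⟩ := exists_between h2
  have hm : 0 ≤ C.R m r := by
    refine le_of_tendsto (hC.shell_focusing r ⟨h5, h4⟩) ?_
    filter_upwards [Ioo_mem_nhdsLT hm2] with s hs
    exact (hanti ⟨hm1.le, hm2⟩ ⟨(hm1.trans hs.1).le, hs.2⟩ hs.1).le
  exact hm.trans_lt (hanti ⟨le_rfl, h2⟩ ⟨hm1.le, hm2⟩ hm1)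

/-- The metric functions of `C` and their first derivatives are differentiable in each variable at
`(t, r)`, and the area radius is nonzero. -/
structure IsRegularAt (C : FluidCloud) (t r : ℝ) : Prop where
  ν_t : HasDerivAt (fun s => C.ν s r) (timeDeriv C.ν t r) t
  ν_r : HasDerivAt (fun s => C.ν t s) (radialDeriv C.ν t r) r
  ψ_t : HasDerivAt (fun s => C.ψ s r) (timeDeriv C.ψ t r) t
  ψ_r : HasDerivAt (fun s => C.ψ t s) (radialDeriv C.ψ t r) r
  R_t : HasDerivAt (fun s => C.R s r) (timeDeriv C.R t r) t
  R_r : HasDerivAt (fun s => C.R t s) (radialDeriv C.R t r) r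
  R_tt : HasDerivAt (fun s => timeDeriv C.R s r) (timeDeriv (timeDeriv C.R) t r) t
  R_tr : HasDerivAt (fun s => timeDeriv C.R t s) (radialDeriv (timeDeriv C.R) t r) r
  R_rt : HasDerivAt (fun s => radialDeriv C.R s r) (timeDeriv (radialDeriv C.R) t r) t
  R_rr : HasDerivAt (fun s => radialDeriv C.R t s) (radialDeriv (radialDeriv C.R) t r) r
  R_ne : C.R t r ≠ 0

lemma IsContinuedCollapse.isRegularAt (hC : C.IsContinuedCollapse) {t r : ℝ}
    (h : (t, r) ∈ C.offCentre) : C.IsRegularAt t r := by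
  have ho := hC.isOpen_offCentre
  have hν := hC.ν_smooth.mono offCentre_subset
  have hψ := hC.ψ_smooth.mono offCentre_subset
  have hR := hC.R_smooth.mono offCentre_subset
  have hRt := contDiffOn_timeDeriv ho hR
  have hRr := contDiffOn_radialDeriv ho hR
  exact
    { ν_t := hasDerivAt_timeDeriv ho hν h
      ν_r := hasDerivAt_radialDeriv ho hν h
      ψ_t := hasDerivAt_timeDeriv ho hψ h
      ψ_r := hasDerivAt_radialDeriv ho hψ h
      R_t := hasDerivAt_timeDeriv ho hR h
      R_r := hasDerivAt_radialDeriv ho hR h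
      R_tt := hasDerivAt_timeDeriv ho hRt h
      R_tr := hasDerivAt_radialDeriv ho hRt h
      R_rt := hasDerivAt_timeDeriv ho hRr h
      R_rr := hasDerivAt_radialDeriv ho hRr h
      R_ne := (hC.R_pos h).ne' }

/-- The region is open along each coordinate line. -/
lemma IsContinuedCollapse.eventually_update_mem (hC : C.IsContinuedCollapse) {x : Coord}
    (hx : x ∈ C.region) (a : Fin 4) : ∀ᶠ s in 𝓝 (x a), Function.update x a s ∈ C.region := by
  have hcont : Continuous fun s : ℝ => Function.update x a s :=
    continuous_const.update a continuous_id
  have hopen : IsOpen C.region := by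
    have : C.region = (fun x : Coord => (x 0, x 1)) ⁻¹' C.offCentre ∩
        ({x | 0 < x 2} ∩ {x | x 2 < Real.pi}) := by
      ext y
      simp only [region, offCentre, mem_ofPred_eq, mem_inter_iff, mem_preimage, and_assoc]
    rw [this]
    refine (hC.isOpen_offCentre.preimage (by fun_prop)).inter (IsOpen.inter ?_ ?_)
    · exact isOpen_lt continuous_const (continuous_apply 2)
    · exact isOpen_lt (continuous_apply 2) continuous_const
  exact hcont.continuousAt.eventually (hopen.mem_nhds (by simpa using hx))

lemma sin_ne_zero_of_mem_region {x : Coord} (hx : x ∈ C.region) : Real.sin (x 2) ≠ 0 :=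
  (Real.sin_pos_of_pos_of_lt_pi hx.2.2.1 hx.2.2.2).ne'

/-! ### Christoffel symbols -/

lemma metric_inv {x : Coord} (hR : C.R (x 0) (x 1) ≠ 0) (hs : Real.sin (x 2) ≠ 0) :
    (C.metric x)⁻¹ = Matrix.diagonal fun a => (C.metric x a a)⁻¹ := by
  refine Matrix.inv_eq_left_inv ?_
  rw [metric, Matrix.diagonal_mul_diagonal, ← Matrix.diagonal_one]
  congr 1
  funext a
  have hne : C.R (x 0) (x 1) ^ 2 * Real.sin (x 2) ^ 2 ≠ 0 := by positivity
  fin_cases a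
  · simp
  · simp
  · simp [hR]
  · exact inv_mul_cancel₀ hne

lemma christoffel_metric {x : Coord} (hR : C.R (x 0) (x 1) ≠ 0) (hs : Real.sin (x 2) ≠ 0)
    (a b c : Fin 4) :
    christoffel C.metric a b c x = (1 / 2) * ((C.metric x a a)⁻¹ *
      (partialD b (fun y => C.metric y a c) x + partialD c (fun y => C.metric y a b) x
        - partialD a (fun y => C.metric y b c) x)) := by
  rw [christoffel, metric_inv hR hs]
  congr 1
  rw [Finset.sum_eq_single a]
  · simp
  · intro d _ hd
    simp [Matrix.diagonal_apply_ne _ hd.symm]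
  · simp

lemma partialD_metric_of_ne {a b : Fin 4} (h : a ≠ b) (c : Fin 4) (x : Coord) :
    partialD c (fun y => C.metric y a b) x = 0 := by
  simp [partialD, metric, Matrix.diagonal_apply_ne _ h]

lemma partialD_metric_diag {x : Coord} (h : C.IsRegularAt (x 0) (x 1)) (c a : Fin 4) :
    partialD c (fun y => C.metric y a a) x =
      (!![-(2 * timeDeriv C.ν (x 0) (x 1) * Real.exp (2 * C.ν (x 0) (x 1))),
          2 * timeDeriv C.ψ (x 0) (x 1) * Real.exp (2 * C.ψ (x 0) (x 1)),
          2 * C.R (x 0) (x 1) * timeDeriv C.R (x 0) (x 1),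
          2 * C.R (x 0) (x 1) * timeDeriv C.R (x 0) (x 1) * Real.sin (x 2) ^ 2;
          -(2 * radialDeriv C.ν (x 0) (x 1) * Real.exp (2 * C.ν (x 0) (x 1))),
          2 * radialDeriv C.ψ (x 0) (x 1) * Real.exp (2 * C.ψ (x 0) (x 1)),
          2 * C.R (x 0) (x 1) * radialDeriv C.R (x 0) (x 1),
          2 * C.R (x 0) (x 1) * radialDeriv C.R (x 0) (x 1) * Real.sin (x 2) ^ 2;
          0, 0, 0, 2 * C.R (x 0) (x 1) ^ 2 * Real.sin (x 2) * Real.cos (x 2);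
          0, 0, 0, 0] : Matrix (Fin 4) (Fin 4) ℝ) c a := by
  have e00 : deriv (fun s => -Real.exp (2 * C.ν s (x 1))) (x 0) =
      -(2 * timeDeriv C.ν (x 0) (x 1) * Real.exp (2 * C.ν (x 0) (x 1))) :=
    (h.ν_t.const_mul 2).exp.neg.deriv.trans (by ring)
  have e01 : deriv (fun s => Real.exp (2 * C.ψ s (x 1))) (x 0) =
      2 * timeDeriv C.ψ (x 0) (x 1) * Real.exp (2 * C.ψ (x 0) (x 1)) :=
    (h.ψ_t.const_mul 2).exp.deriv.trans (by ring)
  have e02 : deriv (fun s => C.R s (x 1) ^ 2) (x 0) =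
      2 * C.R (x 0) (x 1) * timeDeriv C.R (x 0) (x 1) :=
    (h.R_t.pow 2).deriv.trans (by simp)
  have e03 : deriv (fun s => C.R s (x 1) ^ 2 * Real.sin (x 2) ^ 2) (x 0) =
      2 * C.R (x 0) (x 1) * timeDeriv C.R (x 0) (x 1) * Real.sin (x 2) ^ 2 :=
    ((h.R_t.pow 2).mul_const (Real.sin (x 2) ^ 2)).deriv.trans (by simp)
  have e10 : deriv (fun s => -Real.exp (2 * C.ν (x 0) s)) (x 1) =
      -(2 * radialDeriv C.ν (x 0) (x 1) * Real.exp (2 * C.ν (x 0) (x 1))) :=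
    (h.ν_r.const_mul 2).exp.neg.deriv.trans (by ring)
  have e11 : deriv (fun s => Real.exp (2 * C.ψ (x 0) s)) (x 1) =
      2 * radialDeriv C.ψ (x 0) (x 1) * Real.exp (2 * C.ψ (x 0) (x 1)) :=
    (h.ψ_r.const_mul 2).exp.deriv.trans (by ring)
  have e12 : deriv (fun s => C.R (x 0) s ^ 2) (x 1) =
      2 * C.R (x 0) (x 1) * radialDeriv C.R (x 0) (x 1) :=
    (h.R_r.pow 2).deriv.trans (by simp)
  have e13 : deriv (fun s => C.R (x 0) s ^ 2 * Real.sin (x 2) ^ 2) (x 1) =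
      2 * C.R (x 0) (x 1) * radialDeriv C.R (x 0) (x 1) * Real.sin (x 2) ^ 2 :=
    ((h.R_r.pow 2).mul_const (Real.sin (x 2) ^ 2)).deriv.trans (by simp)
  have e23 : deriv (fun s => C.R (x 0) (x 1) ^ 2 * Real.sin s ^ 2) (x 2) =
      2 * C.R (x 0) (x 1) ^ 2 * Real.sin (x 2) * Real.cos (x 2) :=
    (((Real.hasDerivAt_sin (x 2)).pow 2).const_mul (C.R (x 0) (x 1) ^ 2)).deriv.trans
      (by simp; ring)
  fin_cases c <;> fin_cases a
  · exact e00
  · exact e01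
  · exact e02
  · exact e03
  · exact e10
  · exact e11
  · exact e12
  · exact e13
  · simp [partialD, metric]
  · simp [partialD, metric]
  · simp [partialD, metric]
  · exact e23
  all_goals simp [partialD, metric]

lemma christoffel_zero {x : Coord} (h : C.IsRegularAt (x 0) (x 1)) (hs : Real.sin (x 2) ≠ 0)
    (b c : Fin 4) :
    christoffel C.metric 0 b c x =
      (!![timeDeriv C.ν (x 0) (x 1), radialDeriv C.ν (x 0) (x 1), 0, 0;
          radialDeriv C.ν (x 0) (x 1), Real.exp (2 * C.ψ (x 0) (x 1)) /
            Real.exp (2 * C.ν (x 0) (x 1)) * timeDeriv C.ψ (x 0) (x 1), 0, 0;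
          0, 0, C.R (x 0) (x 1) * timeDeriv C.R (x 0) (x 1) / Real.exp (2 * C.ν (x 0) (x 1)), 0;
          0, 0, 0, C.R (x 0) (x 1) * timeDeriv C.R (x 0) (x 1) * Real.sin (x 2) ^ 2 /
            Real.exp (2 * C.ν (x 0) (x 1))] : Matrix (Fin 4) (Fin 4) ℝ) b c := by
  have hm : C.metric x 0 0 = -Real.exp (2 * C.ν (x 0) (x 1)) := by simp [metric]
  rw [christoffel_metric h.R_ne hs, hm]
  fin_cases b <;> fin_cases c <;>
    simp [partialD_metric_of_ne, partialD_metric_diag h] <;> field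

lemma christoffel_one {x : Coord} (h : C.IsRegularAt (x 0) (x 1)) (hs : Real.sin (x 2) ≠ 0)
    (b c : Fin 4) :
    christoffel C.metric 1 b c x =
      (!![Real.exp (2 * C.ν (x 0) (x 1)) / Real.exp (2 * C.ψ (x 0) (x 1)) *
            radialDeriv C.ν (x 0) (x 1), timeDeriv C.ψ (x 0) (x 1), 0, 0;
          timeDeriv C.ψ (x 0) (x 1), radialDeriv C.ψ (x 0) (x 1), 0, 0;
          0, 0, -(C.R (x 0) (x 1) * radialDeriv C.R (x 0) (x 1) /
            Real.exp (2 * C.ψ (x 0) (x 1))), 0;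
          0, 0, 0, -(C.R (x 0) (x 1) * radialDeriv C.R (x 0) (x 1) * Real.sin (x 2) ^ 2 /
            Real.exp (2 * C.ψ (x 0) (x 1)))] : Matrix (Fin 4) (Fin 4) ℝ) b c := by
  have hm : C.metric x 1 1 = Real.exp (2 * C.ψ (x 0) (x 1)) := by simp [metric]
  rw [christoffel_metric h.R_ne hs, hm]
  fin_cases b <;> fin_cases c <;>
    simp [partialD_metric_of_ne, partialD_metric_diag h] <;> field

lemma christoffel_two {x : Coord} (h : C.IsRegularAt (x 0) (x 1)) (hs : Real.sin (x 2) ≠ 0)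
    (b c : Fin 4) :
    christoffel C.metric 2 b c x =
      (!![0, 0, timeDeriv C.R (x 0) (x 1) / C.R (x 0) (x 1), 0;
          0, 0, radialDeriv C.R (x 0) (x 1) / C.R (x 0) (x 1), 0;
          timeDeriv C.R (x 0) (x 1) / C.R (x 0) (x 1),
            radialDeriv C.R (x 0) (x 1) / C.R (x 0) (x 1), 0, 0;
          0, 0, 0, -(Real.sin (x 2) * Real.cos (x 2))] : Matrix (Fin 4) (Fin 4) ℝ) b c := by
  have hm : C.metric x 2 2 = C.R (x 0) (x 1) ^ 2 := by simp [metric]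
  have hR := h.R_ne
  rw [christoffel_metric h.R_ne hs, hm]
  fin_cases b <;> fin_cases c <;>
    simp [partialD_metric_of_ne, partialD_metric_diag h] <;> field

lemma christoffel_three {x : Coord} (h : C.IsRegularAt (x 0) (x 1)) (hs : Real.sin (x 2) ≠ 0)
    (b c : Fin 4) :
    christoffel C.metric 3 b c x =
      (!![0, 0, 0, timeDeriv C.R (x 0) (x 1) / C.R (x 0) (x 1);
          0, 0, 0, radialDeriv C.R (x 0) (x 1) / C.R (x 0) (x 1);
          0, 0, 0, Real.cos (x 2) / Real.sin (x 2);
          timeDeriv C.R (x 0) (x 1) / C.R (x 0) (x 1),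
            radialDeriv C.R (x 0) (x 1) / C.R (x 0) (x 1), Real.cos (x 2) / Real.sin (x 2), 0] :
          Matrix (Fin 4) (Fin 4) ℝ) b c := by
  have hm : C.metric x 3 3 = C.R (x 0) (x 1) ^ 2 * Real.sin (x 2) ^ 2 := by simp [metric]
  have hR := h.R_ne
  rw [christoffel_metric h.R_ne hs, hm]
  fin_cases b <;> fin_cases c <;>
    simp [partialD_metric_of_ne, partialD_metric_diag h] <;> field

/-! ### Kinematics: expansion, shear and null expansions through the area radius -/

/-- The rate of change of the area radius along the fluid, `u^a ∂_a R`. -/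
def areaRate (C : FluidCloud) (t r : ℝ) : ℝ := Real.exp (-C.ν t r) * timeDeriv C.R t r

/-- The rate of change of the area radius in the radial direction, `e^a ∂_a R`. -/
def areaSlope (C : FluidCloud) (t r : ℝ) : ℝ := Real.exp (-C.ψ t r) * radialDeriv C.R t r

lemma lower_metric (V : Coord → Fin 4 → ℝ) (a : Fin 4) (x : Coord) :
    lower C.metric V a x = C.metric x a a * V x a := by
  rw [_root_.lower, Finset.sum_eq_single a]
  · intro b _ hb
    simp [metric, Matrix.diagonal_apply_ne _ hb.symm]
  · simp

lemma exp_two_mul (y : ℝ) : Real.exp (2 * y) = Real.exp y * Real.exp y := by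
  rw [two_mul, Real.exp_add]

lemma lower_u (a : Fin 4) (x : Coord) :
    lower C.metric C.u a x = (![-Real.exp (C.ν (x 0) (x 1)), 0, 0, 0] : Fin 4 → ℝ) a := by
  rw [lower_metric]
  fin_cases a <;> simp [metric, u, exp_two_mul, Real.exp_neg]

lemma lower_e (a : Fin 4) (x : Coord) :
    lower C.metric C.e a x = (![0, Real.exp (C.ψ (x 0) (x 1)), 0, 0] : Fin 4 → ℝ) a := by
  rw [lower_metric]
  fin_cases a <;> simp [metric, e, exp_two_mul, Real.exp_neg]

lemma lower_kOut (a : Fin 4) (x : Coord) :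
    lower C.metric C.kOut a x =
      1 / Real.sqrt 2 * (lower C.metric C.u a x + lower C.metric C.e a x) := by
  simp only [lower_metric, kOut, Pi.smul_apply, Pi.add_apply, smul_eq_mul]
  ring

lemma lower_lIn (a : Fin 4) (x : Coord) :
    lower C.metric C.lIn a x =
      1 / Real.sqrt 2 * (lower C.metric C.u a x - lower C.metric C.e a x) := by
  simp only [lower_metric, lIn, Pi.smul_apply, Pi.sub_apply, smul_eq_mul]
  ring

/-- For `b ≠ 0` the lowered component is identically zero, so only the connection term survives. The
projectors `hUp` and `nUp` never call for `b = 0`. -/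
lemma covD_u (a : Fin 4) {b : Fin 4} (hb : b ≠ 0) (x : Coord) :
    covD C.metric C.u a b x =
      christoffel C.metric 0 a b x * Real.exp (C.ν (x 0) (x 1)) := by
  have h : lower C.metric C.u b = fun _ => 0 := by
    funext y
    rw [lower_u]
    fin_cases b <;> simp at hb ⊢
  rw [covD, h]
  simp [Fin.sum_univ_four, lower_u, partialD]

lemma covD_e (a : Fin 4) {b : Fin 4} (hb : b ≠ 1) (x : Coord) :
    covD C.metric C.e a b x =
      -(christoffel C.metric 1 a b x * Real.exp (C.ψ (x 0) (x 1))) := by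
  have h : lower C.metric C.e b = fun _ => 0 := by
    funext y
    rw [lower_e]
    fin_cases b <;> simp at hb ⊢
  rw [covD, h]
  simp [Fin.sum_univ_four, lower_e, partialD]

lemma covD_kOut (a : Fin 4) {b : Fin 4} (hb : b ≠ 0) (hb' : b ≠ 1) (x : Coord) :
    covD C.metric C.kOut a b x =
      1 / Real.sqrt 2 * (covD C.metric C.u a b x + covD C.metric C.e a b x) := by
  have h : lower C.metric C.kOut b = fun _ => 0 := by
    funext y
    rw [lower_kOut, lower_u, lower_e]
    fin_cases b <;> simp at hb hb' ⊢
  rw [covD_u a hb, covD_e a hb', covD, h]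
  simp [Fin.sum_univ_four, lower_kOut, lower_u, lower_e, partialD]
  ring

lemma covD_lIn (a : Fin 4) {b : Fin 4} (hb : b ≠ 0) (hb' : b ≠ 1) (x : Coord) :
    covD C.metric C.lIn a b x =
      1 / Real.sqrt 2 * (covD C.metric C.u a b x - covD C.metric C.e a b x) := by
  have h : lower C.metric C.lIn b = fun _ => 0 := by
    funext y
    rw [lower_lIn, lower_u, lower_e]
    fin_cases b <;> simp at hb hb' ⊢
  rw [covD_u a hb, covD_e a hb', covD, h]
  simp [Fin.sum_univ_four, lower_lIn, lower_u, lower_e, partialD]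
  ring

lemma hUp_eq {x : Coord} (hR : C.R (x 0) (x 1) ≠ 0) (hs : Real.sin (x 2) ≠ 0) (a b : Fin 4) :
    C.hUp a b x = Matrix.diagonal ![0, (C.metric x 1 1)⁻¹, (C.metric x 2 2)⁻¹,
      (C.metric x 3 3)⁻¹] a b := by
  rw [hUp, metric_inv hR hs]
  fin_cases a <;> fin_cases b <;>
    simp [u, metric, exp_two_mul, Real.exp_neg]

lemma nUp_eq {x : Coord} (hR : C.R (x 0) (x 1) ≠ 0) (hs : Real.sin (x 2) ≠ 0) (a b : Fin 4) :
    C.nUp a b x = Matrix.diagonal ![0, 0, (C.metric x 2 2)⁻¹, (C.metric x 3 3)⁻¹] a b := by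
  rw [nUp, metric_inv hR hs]
  fin_cases a <;> fin_cases b <;>
    simp [u, e, metric, exp_two_mul, Real.exp_neg]

lemma sum_diagonal_mul (d : Fin 4 → ℝ) (f : Fin 4 → Fin 4 → ℝ) :
    ∑ a, ∑ b, Matrix.diagonal d a b * f a b = ∑ a, d a * f a a := by
  refine Finset.sum_congr rfl fun a _ => ?_
  rw [Finset.sum_eq_single a]
  · simp
  · intro b _ hb
    simp [Matrix.diagonal_apply_ne _ hb.symm]
  · simp

section Kinematics

variable {x : Coord} (h : C.IsRegularAt (x 0) (x 1)) (hs : Real.sin (x 2) ≠ 0)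
include h hs

lemma expansion_eq : C.expansion x =
    Real.exp (-C.ν (x 0) (x 1)) * timeDeriv C.ψ (x 0) (x 1) +
      2 * C.areaRate (x 0) (x 1) / C.R (x 0) (x 1) := by
  have hR := h.R_ne
  simp only [expansion, hUp_eq h.R_ne hs, sum_diagonal_mul]
  simp only [Fin.sum_univ_four]
  rw [covD_u 1 (by decide), covD_u 2 (by decide), covD_u 3 (by decide)]
  simp [christoffel_zero h hs, metric, exp_two_mul, Real.exp_neg, areaRate]
  field

lemma shearScalar_eq : C.shearScalar x =
    Real.exp (-C.ν (x 0) (x 1)) * timeDeriv C.ψ (x 0) (x 1) - 1 / 3 * C.expansion x := by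
  have h1 : C.shearScalar x = C.shear 1 1 x * C.e x 1 * C.e x 1 := by
    simp [shearScalar, Fin.sum_univ_four, e]
  have h2 : ∀ a, C.hMixed a 1 x = if a = 1 then 1 else 0 := by
    intro a
    simp [hMixed, lower_u]
  have h3 : C.hDown 1 1 x = Real.exp (2 * C.ψ (x 0) (x 1)) := by
    simp [hDown, lower_u, metric]
  rw [h1, shear, h3]
  simp only [h2, Fin.sum_univ_four]
  simp [covD_u, christoffel_zero h hs, e, exp_two_mul, Real.exp_neg]
  field

lemma sheetExpansion_eq : C.sheetExpansion x =
    2 * C.areaSlope (x 0) (x 1) / C.R (x 0) (x 1) := by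
  have hR := h.R_ne
  simp only [sheetExpansion, nUp_eq h.R_ne hs, sum_diagonal_mul]
  simp only [Fin.sum_univ_four]
  rw [covD_e 2 (by decide), covD_e 3 (by decide)]
  simp [christoffel_one h hs, metric, exp_two_mul, Real.exp_neg, areaSlope]
  field

/-- Here `(2/3)Θ - Σ = Θ - e^{-ν} ∂_t ψ`, which removes the radial stretching and leaves the
expansion of the spheres along `u`. -/
lemma Psi_eq : C.Psi x =
    2 * (C.areaRate (x 0) (x 1) + C.areaSlope (x 0) (x 1)) / C.R (x 0) (x 1) := by
  rw [Psi, shearScalar_eq h hs, sheetExpansion_eq h hs, expansion_eq h hs]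
  ring

lemma sum_nUp_covD_u : ∑ a, ∑ b, C.nUp a b x * covD C.metric C.u b a x =
    2 * C.areaRate (x 0) (x 1) / C.R (x 0) (x 1) := by
  have hR := h.R_ne
  simp only [nUp_eq h.R_ne hs, sum_diagonal_mul]
  simp only [Fin.sum_univ_four]
  rw [covD_u 2 (by decide), covD_u 3 (by decide)]
  simp [christoffel_zero h hs, metric, exp_two_mul, Real.exp_neg, areaRate]
  field

lemma thetaOut_eq : C.thetaOut x = 1 / Real.sqrt 2 *
    (2 * (C.areaRate (x 0) (x 1) + C.areaSlope (x 0) (x 1)) / C.R (x 0) (x 1)) := by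
  have h1 : C.thetaOut x = 1 / Real.sqrt 2 *
      (∑ a, ∑ b, C.nUp a b x * covD C.metric C.u b a x + C.sheetExpansion x) := by
    simp only [thetaOut, sheetExpansion, nUp_eq h.R_ne hs, sum_diagonal_mul]
    simp only [Fin.sum_univ_four]
    rw [covD_kOut 2 (by decide) (by decide), covD_kOut 3 (by decide) (by decide)]
    simp
    ring
  rw [h1, sum_nUp_covD_u h hs, sheetExpansion_eq h hs]
  ring

lemma thetaIn_eq : C.thetaIn x = 1 / Real.sqrt 2 *
    (2 * (C.areaRate (x 0) (x 1) - C.areaSlope (x 0) (x 1)) / C.R (x 0) (x 1)) := by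
  have h1 : C.thetaIn x = 1 / Real.sqrt 2 *
      (∑ a, ∑ b, C.nUp a b x * covD C.metric C.u b a x - C.sheetExpansion x) := by
    simp only [thetaIn, sheetExpansion, nUp_eq h.R_ne hs, sum_diagonal_mul]
    simp only [Fin.sum_univ_four]
    rw [covD_lIn 2 (by decide) (by decide), covD_lIn 3 (by decide) (by decide)]
    simp
    ring
  rw [h1, sum_nUp_covD_u h hs, sheetExpansion_eq h hs]
  ring

end Kinematics

/-! ### Curvature components -/

lemma IsContinuedCollapse.partialD_congr (hC : C.IsContinuedCollapse) {f g : Coord → ℝ}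
    (hfg : EqOn f g C.region) {x : Coord} (hx : x ∈ C.region) (a : Fin 4) :
    partialD a f x = partialD a g x :=
  Filter.EventuallyEq.deriv_eq <| (hC.eventually_update_mem hx a).mono fun _ hs => hfg hs

lemma riemannDown_metric (x : Coord) (a b c d : Fin 4) :
    riemannDown C.metric a b c d x = C.metric x a a * riemann C.metric a b c d x := by
  rw [riemannDown, Finset.sum_eq_single a]
  · intro e _ he
    simp [metric, Matrix.diagonal_apply_ne _ he.symm]
  · simp

section Curvature

variable (hC : C.IsContinuedCollapse) {x : Coord} (hx : x ∈ C.region)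
include hC hx

lemma IsContinuedCollapse.isRegularAt_of_mem_region : C.IsRegularAt (x 0) (x 1) :=
  hC.isRegularAt (mem_offCentre hx)

/-- Every curvature component used below has first index `2`, so these are the only symbols whose
derivatives are needed. -/
lemma partialD_christoffel_two (a b c : Fin 4) :
    partialD a (christoffel C.metric 2 b c) x = partialD a (fun y =>
      (!![0, 0, timeDeriv C.R (y 0) (y 1) / C.R (y 0) (y 1), 0;
          0, 0, radialDeriv C.R (y 0) (y 1) / C.R (y 0) (y 1), 0;
          timeDeriv C.R (y 0) (y 1) / C.R (y 0) (y 1),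
            radialDeriv C.R (y 0) (y 1) / C.R (y 0) (y 1), 0, 0;
          0, 0, 0, -(Real.sin (y 2) * Real.cos (y 2))] : Matrix (Fin 4) (Fin 4) ℝ) b c) x :=
  hC.partialD_congr (fun _ hy => christoffel_two (hC.isRegularAt_of_mem_region hy)
    (sin_ne_zero_of_mem_region hy) b c) hx a

/-- In a warped product `R_{2a2b}`, for `a, b` in the `(t, r)` plane, is `-R` times the Hessian of
`R` there. The next three lemmas are the other instances. -/
lemma riemannDown_2020 : riemannDown C.metric 2 0 2 0 x =
    -C.R (x 0) (x 1) * (timeDeriv (timeDeriv C.R) (x 0) (x 1)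
      - timeDeriv C.ν (x 0) (x 1) * timeDeriv C.R (x 0) (x 1)
      - Real.exp (2 * C.ν (x 0) (x 1)) / Real.exp (2 * C.ψ (x 0) (x 1))
        * radialDeriv C.ν (x 0) (x 1) * radialDeriv C.R (x 0) (x 1)) := by
  have h := hC.isRegularAt_of_mem_region hx
  have hs := sin_ne_zero_of_mem_region hx
  have hR := h.R_ne
  have e1 : partialD 0 (fun y => timeDeriv C.R (y 0) (y 1) / C.R (y 0) (y 1)) x = _ :=
    (h.R_tt.div h.R_t hR).deriv
  rw [riemannDown_metric, riemann, partialD_christoffel_two hC hx,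
    partialD_christoffel_two hC hx]
  simp [Fin.sum_univ_four, christoffel_zero h hs, christoffel_one h hs, christoffel_two h hs,
    christoffel_three h hs, e1]
  simp [partialD, metric]
  field

lemma riemannDown_2121 : riemannDown C.metric 2 1 2 1 x =
    -C.R (x 0) (x 1) * (radialDeriv (radialDeriv C.R) (x 0) (x 1)
      - radialDeriv C.ψ (x 0) (x 1) * radialDeriv C.R (x 0) (x 1)
      - Real.exp (2 * C.ψ (x 0) (x 1)) / Real.exp (2 * C.ν (x 0) (x 1))
        * timeDeriv C.ψ (x 0) (x 1) * timeDeriv C.R (x 0) (x 1)) := by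
  have h := hC.isRegularAt_of_mem_region hx
  have hs := sin_ne_zero_of_mem_region hx
  have hR := h.R_ne
  have e1 : partialD 1 (fun y => radialDeriv C.R (y 0) (y 1) / C.R (y 0) (y 1)) x = _ :=
    (h.R_rr.div h.R_r hR).deriv
  rw [riemannDown_metric, riemann, partialD_christoffel_two hC hx,
    partialD_christoffel_two hC hx]
  simp [Fin.sum_univ_four, christoffel_zero h hs, christoffel_one h hs, christoffel_two h hs,
    christoffel_three h hs, e1]
  simp [partialD, metric]
  field

lemma riemannDown_2021 : riemannDown C.metric 2 0 2 1 x =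
    -C.R (x 0) (x 1) * (radialDeriv (timeDeriv C.R) (x 0) (x 1)
      - radialDeriv C.ν (x 0) (x 1) * timeDeriv C.R (x 0) (x 1)
      - timeDeriv C.ψ (x 0) (x 1) * radialDeriv C.R (x 0) (x 1)) := by
  have h := hC.isRegularAt_of_mem_region hx
  have hs := sin_ne_zero_of_mem_region hx
  have hR := h.R_ne
  have e1 : partialD 1 (fun y => timeDeriv C.R (y 0) (y 1) / C.R (y 0) (y 1)) x = _ :=
    (h.R_tr.div h.R_r hR).deriv
  rw [riemannDown_metric, riemann, partialD_christoffel_two hC hx,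
    partialD_christoffel_two hC hx]
  simp [Fin.sum_univ_four, christoffel_zero h hs, christoffel_one h hs, christoffel_two h hs,
    christoffel_three h hs, e1]
  simp [partialD, metric]
  field

/-- Computed separately from `riemannDown_2021`, so that each order of the mixed derivative of `R`
gets its own equation and their equality is not needed. -/
lemma riemannDown_2120 : riemannDown C.metric 2 1 2 0 x =
    -C.R (x 0) (x 1) * (timeDeriv (radialDeriv C.R) (x 0) (x 1)
      - radialDeriv C.ν (x 0) (x 1) * timeDeriv C.R (x 0) (x 1)
      - timeDeriv C.ψ (x 0) (x 1) * radialDeriv C.R (x 0) (x 1)) := by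
  have h := hC.isRegularAt_of_mem_region hx
  have hs := sin_ne_zero_of_mem_region hx
  have hR := h.R_ne
  have e1 : partialD 0 (fun y => radialDeriv C.R (y 0) (y 1) / C.R (y 0) (y 1)) x = _ :=
    (h.R_rt.div h.R_t hR).deriv
  rw [riemannDown_metric, riemann, partialD_christoffel_two hC hx,
    partialD_christoffel_two hC hx]
  simp [Fin.sum_univ_four, christoffel_zero h hs, christoffel_one h hs, christoffel_two h hs,
    christoffel_three h hs, e1]
  simp [partialD, metric]
  field

/-- The Gauss equation of the spheres: the last factor is `1 - |∇R|²`. -/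
lemma riemannDown_2323 : riemannDown C.metric 2 3 2 3 x =
    C.R (x 0) (x 1) ^ 2 * Real.sin (x 2) ^ 2 *
      (1 + C.areaRate (x 0) (x 1) ^ 2 - C.areaSlope (x 0) (x 1) ^ 2) := by
  have h := hC.isRegularAt_of_mem_region hx
  have hs := sin_ne_zero_of_mem_region hx
  have hR := h.R_ne
  have e1 : partialD 2 (fun y => -(Real.sin (y 2) * Real.cos (y 2))) x =
      Real.sin (x 2) ^ 2 - Real.cos (x 2) ^ 2 :=
    ((Real.hasDerivAt_sin (x 2)).mul (Real.hasDerivAt_cos (x 2))).neg.deriv.trans (by ring)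
  rw [riemannDown_metric, riemann, partialD_christoffel_two hC hx,
    partialD_christoffel_two hC hx]
  simp [Fin.sum_univ_four, christoffel_zero h hs, christoffel_one h hs, christoffel_two h hs,
    christoffel_three h hs, e1]
  simp [partialD, metric, areaRate, areaSlope, exp_two_mul, Real.exp_neg]
  field_simp
  ring

end Curvature

/-! ### Einstein's equations with vanishing Weyl tensor -/

section FieldEquations

variable (hC : C.IsContinuedCollapse) {x : Coord} (hx : x ∈ C.region)
include hC hx

lemma einstein_eq_diagonal (a b : Fin 4) : einstein C.metric a b x =
    Matrix.diagonal ![C.μ (x 0) (x 1) * Real.exp (2 * C.ν (x 0) (x 1)),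
      C.p (x 0) (x 1) * C.metric x 1 1, C.p (x 0) (x 1) * C.metric x 2 2,
      C.p (x 0) (x 1) * C.metric x 3 3] a b := by
  rw [hC.perfect_fluid x hx, hDown]
  fin_cases a <;> fin_cases b <;> simp [lower_u, metric, exp_two_mul]
  ring

/-- In dimension four the trace of `G` is `R - 2R = -R` for the scalar curvature `R`. -/
lemma scalarCurv_eq_neg_trace : scalarCurv C.metric x =
    -∑ a, (C.metric x a a)⁻¹ * einstein C.metric a a x := by
  have h := hC.isRegularAt_of_mem_region hx
  have hs := sin_ne_zero_of_mem_region hx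
  have hR := h.R_ne
  have hne : ∀ a, C.metric x a a ≠ 0 := by
    intro a
    have : C.R (x 0) (x 1) ^ 2 * Real.sin (x 2) ^ 2 ≠ 0 := by positivity
    fin_cases a
    · simp [metric]
    · simp [metric]
    · simp [metric, hR]
    · exact this
  have h1 : scalarCurv C.metric x = ∑ a, (C.metric x a a)⁻¹ * ricci C.metric a a x := by
    rw [scalarCurv, metric_inv hR hs, sum_diagonal_mul]
  have h2 : ∑ a, (C.metric x a a)⁻¹ * einstein C.metric a a x =
      ∑ a, (C.metric x a a)⁻¹ * ricci C.metric a a x - 2 * scalarCurv C.metric x := by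
    have : ∀ a, (C.metric x a a)⁻¹ * einstein C.metric a a x =
        (C.metric x a a)⁻¹ * ricci C.metric a a x - (1 / 2) * scalarCurv C.metric x := by
      intro a
      have := hne a
      rw [einstein]
      field_simp
    simp only [this, Finset.sum_sub_distrib]
    simp
    ring
  rw [h2, ← h1]
  ring

lemma scalarCurv_eq : scalarCurv C.metric x =
    C.μ (x 0) (x 1) - 3 * C.p (x 0) (x 1) := by
  have h := hC.isRegularAt_of_mem_region hx
  have hs := sin_ne_zero_of_mem_region hx
  have hR := h.R_ne
  rw [scalarCurv_eq_neg_trace hC hx]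
  simp [einstein_eq_diagonal hC hx, Fin.sum_univ_four, metric]
  field

lemma ricci_eq (a b : Fin 4) : ricci C.metric a b x =
    Matrix.diagonal ![(C.μ (x 0) (x 1) + 3 * C.p (x 0) (x 1)) / 2 *
        Real.exp (2 * C.ν (x 0) (x 1)),
      (C.μ (x 0) (x 1) - C.p (x 0) (x 1)) / 2 * C.metric x 1 1,
      (C.μ (x 0) (x 1) - C.p (x 0) (x 1)) / 2 * C.metric x 2 2,
      (C.μ (x 0) (x 1) - C.p (x 0) (x 1)) / 2 * C.metric x 3 3] a b := by
  have h1 : ricci C.metric a b x = einstein C.metric a b x +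
      (1 / 2) * scalarCurv C.metric x * C.metric x a b := by
    rw [einstein]
    ring
  rw [h1, scalarCurv_eq hC hx, einstein_eq_diagonal hC hx]
  fin_cases a <;> fin_cases b <;> simp [metric] <;> ring

variable (hflat : C.IsConformallyFlat)
include hflat

/-- The Ricci decomposition without its Weyl part. Equated with the components computed from the
metric, it yields all the equations for the area radius. -/
lemma riemannDown_of_flat (a b c d : Fin 4) : riemannDown C.metric a b c d x =
    (1 / 2) * (C.metric x a c * ricci C.metric b d x - C.metric x a d * ricci C.metric b c x
        - C.metric x b c * ricci C.metric a d x + C.metric x b d * ricci C.metric a c x)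
    - (1 / 6) * (C.μ (x 0) (x 1) - 3 * C.p (x 0) (x 1)) *
      (C.metric x a c * C.metric x b d - C.metric x a d * C.metric x b c) := by
  have h := hflat x hx a b c d
  rw [weyl, scalarCurv_eq hC hx] at h
  linarith

lemma areaRate_sq_sub_areaSlope_sq_chart :
    1 + C.areaRate (x 0) (x 1) ^ 2 - C.areaSlope (x 0) (x 1) ^ 2 =
      C.μ (x 0) (x 1) / 3 * C.R (x 0) (x 1) ^ 2 := by
  have h := (riemannDown_2323 hC hx).symm.trans (riemannDown_of_flat hC hx hflat 2 3 2 3)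
  have hR := (hC.isRegularAt_of_mem_region hx).R_ne
  have hs := sin_ne_zero_of_mem_region hx
  have hne : C.R (x 0) (x 1) ^ 2 * Real.sin (x 2) ^ 2 ≠ 0 := by positivity
  simp [ricci_eq hC hx, metric] at h
  refine mul_left_cancel₀ hne ?_
  linear_combination h

lemma time_time_chart : timeDeriv (timeDeriv C.R) (x 0) (x 1)
      - timeDeriv C.ν (x 0) (x 1) * timeDeriv C.R (x 0) (x 1)
      - Real.exp (2 * C.ν (x 0) (x 1)) / Real.exp (2 * C.ψ (x 0) (x 1))
        * radialDeriv C.ν (x 0) (x 1) * radialDeriv C.R (x 0) (x 1) =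
    -(Real.exp (2 * C.ν (x 0) (x 1)) * C.R (x 0) (x 1) *
      (C.μ (x 0) (x 1) + 3 * C.p (x 0) (x 1)) / 6) := by
  have h := (riemannDown_2020 hC hx).symm.trans (riemannDown_of_flat hC hx hflat 2 0 2 0)
  have hR := (hC.isRegularAt_of_mem_region hx).R_ne
  simp only [ricci_eq hC hx] at h
  simp [metric] at h
  refine mul_left_cancel₀ hR ?_
  linear_combination -h

lemma radial_radial_chart : radialDeriv (radialDeriv C.R) (x 0) (x 1)
      - radialDeriv C.ψ (x 0) (x 1) * radialDeriv C.R (x 0) (x 1)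
      - Real.exp (2 * C.ψ (x 0) (x 1)) / Real.exp (2 * C.ν (x 0) (x 1))
        * timeDeriv C.ψ (x 0) (x 1) * timeDeriv C.R (x 0) (x 1) =
    -(Real.exp (2 * C.ψ (x 0) (x 1)) * C.R (x 0) (x 1) * C.μ (x 0) (x 1) / 3) := by
  have h := (riemannDown_2121 hC hx).symm.trans (riemannDown_of_flat hC hx hflat 2 1 2 1)
  have hR := (hC.isRegularAt_of_mem_region hx).R_ne
  simp only [ricci_eq hC hx] at h
  simp [metric] at h
  refine mul_left_cancel₀ hR ?_
  linear_combination -h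

lemma time_radial_chart : radialDeriv (timeDeriv C.R) (x 0) (x 1)
      - radialDeriv C.ν (x 0) (x 1) * timeDeriv C.R (x 0) (x 1)
      - timeDeriv C.ψ (x 0) (x 1) * radialDeriv C.R (x 0) (x 1) = 0 := by
  have h := (riemannDown_2021 hC hx).symm.trans (riemannDown_of_flat hC hx hflat 2 0 2 1)
  have hR := (hC.isRegularAt_of_mem_region hx).R_ne
  simp only [ricci_eq hC hx] at h
  refine (mul_eq_zero.1 (h.trans ?_)).resolve_left (neg_ne_zero.2 hR)
  simp [metric]

lemma radial_time_chart : timeDeriv (radialDeriv C.R) (x 0) (x 1)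
      - radialDeriv C.ν (x 0) (x 1) * timeDeriv C.R (x 0) (x 1)
      - timeDeriv C.ψ (x 0) (x 1) * radialDeriv C.R (x 0) (x 1) = 0 := by
  have h := (riemannDown_2120 hC hx).symm.trans (riemannDown_of_flat hC hx hflat 2 1 2 0)
  have hR := (hC.isRegularAt_of_mem_region hx).R_ne
  simp only [ricci_eq hC hx] at h
  refine (mul_eq_zero.1 (h.trans ?_)).resolve_left (neg_ne_zero.2 hR)
  simp [metric]

end FieldEquations

/-! ### Constraint and evolution equations on the `(t, r)` plane -/

/-- The chart point on the equator of the sphere `(t, r)`. -/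
def equator (t r : ℝ) : Coord := ![t, r, Real.pi / 2, 0]

lemma equator_mem {t r : ℝ} (h : (t, r) ∈ C.offCentre) : equator t r ∈ C.region := by
  refine ⟨h.1, h.2, ?_, ?_⟩ <;> simp [equator] <;> linarith [Real.pi_pos]

section Evolution

variable (hC : C.IsContinuedCollapse) (hflat : C.IsConformallyFlat) {t r : ℝ}
  (h : (t, r) ∈ C.offCentre)
include hC hflat h

lemma areaRate_sq_sub_areaSlope_sq :
    1 + C.areaRate t r ^ 2 - C.areaSlope t r ^ 2 = C.μ t r / 3 * C.R t r ^ 2 :=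
  areaRate_sq_sub_areaSlope_sq_chart hC (equator_mem h) hflat

lemma hasDerivAt_areaRate_time : HasDerivAt (fun s => C.areaRate s r)
    (Real.exp (C.ν t r) * (Real.exp (-C.ψ t r) * radialDeriv C.ν t r * C.areaSlope t r
      - C.R t r * (C.μ t r + 3 * C.p t r) / 6)) t := by
  have hr := hC.isRegularAt h
  have key : timeDeriv (timeDeriv C.R) t r - timeDeriv C.ν t r * timeDeriv C.R t r
      - Real.exp (2 * C.ν t r) / Real.exp (2 * C.ψ t r) * radialDeriv C.ν t r * radialDeriv C.R t r
      = -(Real.exp (2 * C.ν t r) * C.R t r * (C.μ t r + 3 * C.p t r) / 6) :=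
    time_time_chart hC (equator_mem h) hflat
  refine (hr.ν_t.neg.exp.mul hr.R_tt).congr_deriv ?_
  simp only [Pi.neg_apply]
  rw [sub_sub, sub_eq_iff_eq_add] at key
  rw [key, exp_two_mul, exp_two_mul, areaSlope, Real.exp_neg, Real.exp_neg]
  field

lemma hasDerivAt_areaRate_radial : HasDerivAt (fun s => C.areaRate t s)
    (Real.exp (C.ψ t r) * (Real.exp (-C.ν t r) * timeDeriv C.ψ t r * C.areaSlope t r)) r := by
  have hr := hC.isRegularAt h
  have key : radialDeriv (timeDeriv C.R) t r - radialDeriv C.ν t r * timeDeriv C.R t r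
      - timeDeriv C.ψ t r * radialDeriv C.R t r = 0 :=
    time_radial_chart hC (equator_mem h) hflat
  refine (hr.ν_r.neg.exp.mul hr.R_tr).congr_deriv ?_
  simp only [Pi.neg_apply]
  rw [sub_sub, sub_eq_iff_eq_add] at key
  rw [key, areaSlope, Real.exp_neg, Real.exp_neg]
  field

lemma hasDerivAt_areaSlope_time : HasDerivAt (fun s => C.areaSlope s r)
    (Real.exp (C.ν t r) * (Real.exp (-C.ψ t r) * radialDeriv C.ν t r * C.areaRate t r)) t := by
  have hr := hC.isRegularAt h
  have key : timeDeriv (radialDeriv C.R) t r - radialDeriv C.ν t r * timeDeriv C.R t r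
      - timeDeriv C.ψ t r * radialDeriv C.R t r = 0 :=
    radial_time_chart hC (equator_mem h) hflat
  refine (hr.ψ_t.neg.exp.mul hr.R_rt).congr_deriv ?_
  simp only [Pi.neg_apply]
  rw [sub_sub, sub_eq_iff_eq_add] at key
  rw [key, areaRate, Real.exp_neg, Real.exp_neg]
  field

lemma hasDerivAt_areaSlope_radial : HasDerivAt (fun s => C.areaSlope t s)
    (Real.exp (C.ψ t r) * (Real.exp (-C.ν t r) * timeDeriv C.ψ t r * C.areaRate t r
      - C.R t r * C.μ t r / 3)) r := by
  have hr := hC.isRegularAt h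
  have key : radialDeriv (radialDeriv C.R) t r - radialDeriv C.ψ t r * radialDeriv C.R t r
      - Real.exp (2 * C.ψ t r) / Real.exp (2 * C.ν t r) * timeDeriv C.ψ t r * timeDeriv C.R t r
      = -(Real.exp (2 * C.ψ t r) * C.R t r * C.μ t r / 3) :=
    radial_radial_chart hC (equator_mem h) hflat
  refine (hr.ψ_r.neg.exp.mul hr.R_rr).congr_deriv ?_
  simp only [Pi.neg_apply]
  rw [sub_sub, sub_eq_iff_eq_add] at key
  rw [key, exp_two_mul, exp_two_mul, areaRate, Real.exp_neg, Real.exp_neg]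
  field

/-- The compactness `μ R² / 3` of a shell changes in time according to the strong energy
density. -/
lemma hasDerivAt_compactness : HasDerivAt (fun s => C.μ s r / 3 * C.R s r ^ 2)
    (-(Real.exp (C.ν t r) * C.areaRate t r * C.R t r * (C.μ t r + 3 * C.p t r) / 3)) t := by
  -- `μ` is only assumed continuous, so the constraint's other side `1 + U² - S²` is differentiated;
  -- the `∂_r ν` terms cancel.
  have hd := (((hasDerivAt_areaRate_time hC hflat h).pow 2).const_add 1).sub
    ((hasDerivAt_areaSlope_time hC hflat h).pow 2)
  have hev : ∀ᶠ s in 𝓝 t, (s, r) ∈ C.offCentre :=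
    (Continuous.continuousAt (f := fun s : ℝ => (s, r)) (by fun_prop)).eventually
      (hC.isOpen_offCentre.mem_nhds h)
  refine (hd.congr_of_eventuallyEq (hev.mono fun s hs =>
    (areaRate_sq_sub_areaSlope_sq hC hflat hs).symm)).congr_deriv ?_
  simp
  ring

/-- The density of a conformally flat perfect fluid is homogeneous. -/
lemma hasDerivAt_density_radial : HasDerivAt (fun s => C.μ t s) 0 r := by
  have hr := hC.isRegularAt h
  -- Again `μ` is replaced by the differentiable expression `3(1 + U² - S²)/R²`.
  have hd := (((((hasDerivAt_areaRate_radial hC hflat h).pow 2).const_add 1).sub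
    ((hasDerivAt_areaSlope_radial hC hflat h).pow 2)).const_mul 3).div (hr.R_r.pow 2)
    (pow_ne_zero 2 hr.R_ne)
  have hev : ∀ᶠ s in 𝓝 r, (t, s) ∈ C.offCentre :=
    (Continuous.continuousAt (f := fun s : ℝ => (t, s)) (by fun_prop)).eventually
      (hC.isOpen_offCentre.mem_nhds h)
  refine (hd.congr_of_eventuallyEq (hev.mono fun s hs => ?_)).congr_deriv ?_
  · have h1 := areaRate_sq_sub_areaSlope_sq hC hflat hs
    have h2 := (hC.isRegularAt hs).R_ne
    simp only [Pi.div_apply, Pi.pow_apply, Pi.sub_apply]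
    rw [h1]
    field
  · have h1 := areaRate_sq_sub_areaSlope_sq hC hflat h
    have h2 := hr.R_ne
    have h3 : radialDeriv C.R t r = Real.exp (C.ψ t r) * C.areaSlope t r := by
      rw [areaSlope, ← mul_assoc, ← Real.exp_add]
      simp
    simp only [Pi.pow_apply, Pi.sub_apply]
    rw [h1, h3, div_eq_zero_iff]
    left
    simp
    ring

end Evolution

/-! ### Trapped spheres, the horizon and compactness -/

section Trapping

variable (hC : C.IsContinuedCollapse) {t r : ℝ} (h : (t, r) ∈ C.offCentre)
include hC h

lemma areaRate_neg : C.areaRate t r < 0 :=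
  mul_neg_of_pos_of_neg (Real.exp_pos _) (hC.collapsing t r h.1 h.2)

lemma areaSlope_pos : 0 < C.areaSlope t r :=
  mul_pos (Real.exp_pos _) (hC.no_shell_crossing t r h.1 h.2)

lemma R_lt_R_of_lt {r' : ℝ} (hr : r < r') (hr' : r' < C.rb) : C.R t r < C.R t r' := by
  obtain ⟨⟨h1, h2, h3, h4⟩, h5⟩ := h
  simp only at h1 h2 h3 h4 h5
  have hmem : ∀ s ∈ Icc r r', (t, s) ∈ C.offCentre := fun s hs =>
    ⟨⟨h1, h2.trans_le (hC.ts_monotone ⟨h3, h4⟩ ⟨h3.trans hs.1, hs.2.trans_lt hr'⟩ hs.1),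
      h3.trans hs.1, hs.2.trans_lt hr'⟩, h5.trans_le hs.1⟩
  refine strictMonoOn_of_deriv_pos (f := fun s => C.R t s) (convex_Icc r r')
    (fun s hs => (hC.isRegularAt (hmem s hs)).R_r.continuousAt.continuousWithinAt)
    (fun s hs => ?_) ⟨le_rfl, hr.le⟩ ⟨hr.le, le_rfl⟩ hr
  have hs' := hmem s (interior_subset hs)
  exact hC.no_shell_crossing t s hs'.1 hs'.2

end Trapping

/-- A sphere of a conformally flat cloud is trapped as soon as its compactness exceeds `1`. -/
lemma isTrapped_of_one_lt (hC : C.IsContinuedCollapse) (hflat : C.IsConformallyFlat) {x : Coord}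
    (hx : x ∈ C.region) (h1 : 1 < C.μ (x 0) (x 1) / 3 * C.R (x 0) (x 1) ^ 2) :
    C.IsTrapped x := by
  have h := mem_offCentre hx
  have hr := hC.isRegularAt h
  have hs := sin_ne_zero_of_mem_region hx
  have hR := hC.R_pos h
  have hU := areaRate_neg hC h
  have hS := areaSlope_pos hC h
  rw [← areaRate_sq_sub_areaSlope_sq hC hflat h] at h1
  have hc : 0 < 1 / Real.sqrt 2 := by positivity
  have hlt : C.areaRate (x 0) (x 1) + C.areaSlope (x 0) (x 1) < 0 := by
    -- `U + S ≥ 0` with `U < 0 < S` would give `U² ≤ S²`, against `1 < 1 + U² - S²`.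
    by_contra! hcon
    nlinarith
  refine ⟨?_, ?_⟩
  · rw [thetaOut_eq hr hs]
    exact mul_neg_of_pos_of_neg hc (div_neg_of_neg_of_pos (by linarith) hR)
  · rw [thetaIn_eq hr hs]
    exact mul_neg_of_pos_of_neg hc (div_neg_of_neg_of_pos (by linarith) hR)

lemma areaRate_add_areaSlope_eq_zero (hC : C.IsContinuedCollapse) {x : Coord}
    (hx : x ∈ C.apparentHorizon) : C.areaRate (x 0) (x 1) + C.areaSlope (x 0) (x 1) = 0 := by
  have hr := hC.isRegularAt (mem_offCentre hx.1)
  have h0 := hx.2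
  rw [thetaOut_eq hr (sin_ne_zero_of_mem_region hx.1)] at h0
  have hc : 1 / Real.sqrt 2 ≠ 0 := by positivity
  have := (div_eq_zero_iff.1 ((mul_eq_zero.1 h0).resolve_left hc)).resolve_right hr.R_ne
  linarith

lemma compactness_eq_one (hC : C.IsContinuedCollapse) (hflat : C.IsConformallyFlat) {x : Coord}
    (hx : x ∈ C.apparentHorizon) : C.μ (x 0) (x 1) / 3 * C.R (x 0) (x 1) ^ 2 = 1 := by
  have h := areaRate_add_areaSlope_eq_zero hC hx
  rw [← areaRate_sq_sub_areaSlope_sq hC hflat (mem_offCentre hx.1)]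
  linear_combination (C.areaRate (x 0) (x 1) - C.areaSlope (x 0) (x 1)) * h

lemma density_pos_of_horizon (hC : C.IsContinuedCollapse) (hflat : C.IsConformallyFlat)
    {x : Coord} (hx : x ∈ C.apparentHorizon) : 0 < C.μ (x 0) (x 1) := by
  have h := compactness_eq_one hC hflat hx
  by_contra! hcon
  nlinarith [sq_nonneg (C.R (x 0) (x 1))]

/-! ### Homogeneous density and the black hole end state -/

lemma mem_domain_of_lt_ts_zero (hC : C.IsContinuedCollapse) {t r : ℝ} (h1 : C.t0 < t)
    (h2 : t < C.ts 0) (h3 : 0 ≤ r) (h4 : r < C.rb) : (t, r) ∈ C.domain :=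
  ⟨h1, h2.trans_le (hC.ts_monotone ⟨le_rfl, hC.rb_pos⟩ ⟨h3, h4⟩ h3), h3, h4⟩

/-- The mean value theorem on `[0, r]`: the radial derivative vanishes off the centre and `μ` is
continuous up to it. The bound `t < ts 0` keeps the whole segment in the domain. -/
lemma density_eq_centre (hC : C.IsContinuedCollapse) (hflat : C.IsConformallyFlat) {t r : ℝ}
    (h1 : C.t0 < t) (h2 : t < C.ts 0) (h3 : 0 ≤ r) (h4 : r < C.rb) : C.μ t r = C.μ t 0 := by
  have hmem : ∀ s ∈ Icc 0 r, (t, s) ∈ C.domain := fun s hs =>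
    mem_domain_of_lt_ts_zero hC h1 h2 hs.1 (hs.2.trans_lt h4)
  have hcont : ContinuousOn (fun s => C.μ t s) (Icc 0 r) :=
    hC.μ_continuous.comp (f := fun s : ℝ => (t, s)) (by fun_prop) hmem
  have hd : ∀ s ∈ Ioo 0 r, HasDerivAt (fun s => C.μ t s) 0 s := fun s hs =>
    hasDerivAt_density_radial hC hflat ⟨hmem s (Ioo_subset_Icc_self hs), hs.1⟩
  rcases h3.eq_or_lt with rfl | h3
  · rfl
  obtain ⟨c, hc, hslope⟩ := exists_hasDerivAt_eq_slope _ _ h3 hcont hd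
  have := (div_eq_zero_iff.1 hslope.symm).resolve_right (by linarith)
  linarith

/-- All shells of a conformally flat cloud become singular simultaneously. -/
lemma ts_eq_centre (hC : C.IsContinuedCollapse) (hflat : C.IsConformallyFlat) {r : ℝ}
    (h3 : 0 ≤ r) (h4 : r < C.rb) : C.ts r = C.ts 0 := by
  refine le_antisymm (le_of_not_gt fun hlt => ?_)
    (hC.ts_monotone ⟨le_rfl, hC.rb_pos⟩ ⟨h3, h4⟩ h3)
  -- A later singular time would make `(ts 0, r)` a regular point, where `μ` has a finite limit; by
  -- homogeneity this would also be the limit of the diverging central density.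
  have hmem : (C.ts 0, r) ∈ C.domain := ⟨hC.t0_lt, hlt, h3, h4⟩
  have hsub : ∀ᶠ t in 𝓝[<] (C.ts 0), t ∈ Ioo C.t0 (C.ts 0) := Ioo_mem_nhdsLT hC.t0_lt
  have hpath : Tendsto (fun t : ℝ => (t, r)) (𝓝[<] (C.ts 0)) (𝓝[C.domain] (C.ts 0, r)) := by
    refine tendsto_nhdsWithin_iff.2 ⟨?_, hsub.mono fun t ht =>
      mem_domain_of_lt_ts_zero hC ht.1 ht.2 h3 h4⟩
    exact (Continuous.tendsto (f := fun t : ℝ => (t, r)) (by fun_prop) _).mono_left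
      nhdsWithin_le_nhds
  have hlim := (hC.μ_continuous _ hmem).tendsto.comp hpath
  refine not_tendsto_nhds_of_tendsto_atTop hC.central_singularity _
    (hlim.congr' (hsub.mono fun t ht => ?_))
  exact density_eq_centre hC hflat ht.1 ht.2 h3 h4

/-- The time derivative is a positive multiple of `-U R (μ + 3p)`, which is nonnegative because `U <
0 < R`. -/
lemma compactness_le (hC : C.IsContinuedCollapse) (hSEC : C.StrongEnergyCondition)
    (hflat : C.IsConformallyFlat) {t t' r : ℝ} (h : (t, r) ∈ C.offCentre) (ht : t ≤ t')
    (ht' : t' < C.ts r) : C.μ t r / 3 * C.R t r ^ 2 ≤ C.μ t' r / 3 * C.R t' r ^ 2 := by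
  have hmem : ∀ s ∈ Icc t t', (s, r) ∈ C.offCentre := fun s hs =>
    ⟨⟨h.1.1.trans_le hs.1, hs.2.trans_lt ht', h.1.2.2⟩, h.2⟩
  have hd := fun s hs => hasDerivAt_compactness hC hflat (hmem s hs)
  refine monotoneOn_of_deriv_nonneg (f := fun s => C.μ s r / 3 * C.R s r ^ 2) (convex_Icc t t')
    (fun s hs => (hd s hs).continuousAt.continuousWithinAt)
    (fun s hs => (hd s (interior_subset hs)).differentiableAt.differentiableWithinAt)
    (fun s hs => ?_) ⟨le_rfl, ht⟩ ⟨ht, le_rfl⟩ ht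
  have hs' := hmem s (interior_subset hs)
  rw [(hd s (interior_subset hs)).deriv]
  have h1 := areaRate_neg hC hs'
  have h2 := hC.R_pos hs'
  have h3 := (hSEC s r hs'.1).2
  have h4 : 0 ≤ Real.exp (C.ν s r) * -C.areaRate s r * C.R s r * (C.μ s r + 3 * C.p s r) / 3 := by
    have : 0 ≤ -C.areaRate s r := by linarith
    positivity
  linarith

/-- Once the apparent horizon has reached the centre every shell gets trapped. -/
lemma exists_trapped_after (hC : C.IsContinuedCollapse) (hSEC : C.StrongEnergyCondition)
    (hflat : C.IsConformallyFlat) (hAH : C.HorizonReachesCentralSingularity) {r : ℝ}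
    (hr : r ∈ Ioo 0 C.rb) : ∃ t₁, C.t0 < t₁ ∧ t₁ < C.ts 0 ∧
      ∀ x ∈ C.region, x 1 = r → t₁ ≤ x 0 → C.IsTrapped x := by
  -- Taking `ε = r` puts the horizon point on a shell inside `r`. Its closeness in time is not
  -- needed: simultaneity of the singularity already gives `y 0 < ts 0`.
  obtain ⟨y, hy, -, hyr⟩ := hAH r hr.1
  obtain ⟨⟨hy1, hy2, hy3, hy4⟩, hy5⟩ := mem_offCentre hy.1
  simp only at hy1 hy2 hy3 hy4 hy5
  have hy6 : y 0 < C.ts 0 := ts_eq_centre hC hflat hy3 hy4 ▸ hy2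
  refine ⟨y 0, hy1, hy6, fun x hx hxr ht => isTrapped_of_one_lt hC hflat hx ?_⟩
  have hmem : (y 0, r) ∈ C.offCentre :=
    ⟨mem_domain_of_lt_ts_zero hC hy1 hy6 hr.1.le hr.2, hr.1⟩
  rw [hxr]
  refine lt_of_lt_of_le ?_ (compactness_le hC hSEC hflat hmem ht (hxr ▸ hx.1.2.1))
  rw [← compactness_eq_one hC hflat hy, density_eq_centre hC hflat hy1 hy6 hr.1.le hr.2,
    ← density_eq_centre hC hflat hy1 hy6 hy3 hy4]
  have hμ := density_pos_of_horizon hC hflat hy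
  have hR := hC.R_pos (mem_offCentre hy.1)
  have hlt := R_lt_R_of_lt hC (mem_offCentre hy.1) hyr hr.2
  gcongr

lemma IsOutgoingNullRay.time_le {γ : ℝ → Coord} (hγ : C.IsOutgoingNullRay γ) :
    γ 0 0 ≤ γ 1 0 := by
  obtain ⟨hc, -, -, κ, hκ⟩ := hγ
  have hd : ∀ s ∈ Ioo (0 : ℝ) 1, HasDerivAt (fun s => γ s 0) ((κ s • C.kOut (γ s)) 0) s :=
    fun s hs => hasDerivAt_pi.1 (hκ s hs).2 0
  refine monotoneOn_of_deriv_nonneg (f := fun s => γ s 0) (convex_Icc 0 1)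
    (fun s hs => (continuous_apply 0).continuousAt.comp_continuousWithinAt (hc s hs))
    (fun s hs => ?_) (fun s hs => ?_) ⟨le_rfl, zero_le_one⟩ ⟨zero_le_one, le_rfl⟩ zero_le_one
  · rw [interior_Icc] at hs
    exact (hd s hs).differentiableAt.differentiableWithinAt
  · rw [interior_Icc] at hs
    rw [(hd s hs).deriv]
    have := (hκ s hs).1
    simp only [kOut, u, e, Pi.smul_apply, Pi.add_apply, smul_eq_mul, Matrix.cons_val_zero]
    positivity

lemma endStateIsBlackHole (hC : C.IsContinuedCollapse) (hSEC : C.StrongEnergyCondition)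
    (hflat : C.IsConformallyFlat) (hAH : C.HorizonReachesCentralSingularity) :
    C.EndStateIsBlackHole := by
  refine ⟨fun r hr => exists_trapped_after hC hSEC hflat hAH hr, ?_⟩
  rintro ⟨r₁, hr₁, hnaked⟩
  obtain ⟨t₁, -, ht₁, htrap⟩ := exists_trapped_after hC hSEC hflat hAH hr₁
  -- This `ε` forces the ray to start after `t₁`. Time does not decrease along it, so its endpoint
  -- lies on a trapped sphere.
  obtain ⟨γ, hγ, hstart, -, hend, hout⟩ := hnaked (C.ts 0 - t₁) (by linarith)
  have h1 : (1 : ℝ) ∈ Ioc (0 : ℝ) 1 := ⟨one_pos, le_rfl⟩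
  have ht : t₁ ≤ γ 1 0 := by
    have := (abs_lt.1 hstart).1
    have := hγ.time_le
    linarith
  exact absurd (htrap _ (hγ.2.2.1 1 h1) hend ht).1 (not_lt.2 (hout 1 h1))

/-! ### Horizon tangents -/

/-- The derivative of `Ψ` in the `[u, e]` plane at the apparent horizon. -/
lemma dirD_Psi (hC : C.IsContinuedCollapse) (hflat : C.IsConformallyFlat) {x : Coord}
    (hx : x ∈ C.apparentHorizon) (α β : ℝ) : dirD (C.planeVec α β x) C.Psi x =
      -(α * (C.μ (x 0) (x 1) / 3 + C.p (x 0) (x 1)) + β * (2 / 3 * C.μ (x 0) (x 1))) := by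
  have h := mem_offCentre hx.1
  have hr := hC.isRegularAt h
  have hR := hr.R_ne
  have h0 := areaRate_add_areaSlope_eq_zero hC hx
  have heq : EqOn C.Psi (fun y => 2 * (C.areaRate (y 0) (y 1) + C.areaSlope (y 0) (y 1)) /
      C.R (y 0) (y 1)) C.region := fun y hy =>
    Psi_eq (hC.isRegularAt (mem_offCentre hy)) (sin_ne_zero_of_mem_region hy)
  have ht : partialD 0 C.Psi x = -(Real.exp (C.ν (x 0) (x 1)) *
      (C.μ (x 0) (x 1) / 3 + C.p (x 0) (x 1))) := by
    rw [hC.partialD_congr heq hx.1]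
    refine ((((hasDerivAt_areaRate_time hC hflat h).add
      (hasDerivAt_areaSlope_time hC hflat h)).const_mul 2).div hr.R_t hR).deriv.trans ?_
    simp only [Pi.add_apply]
    -- On the horizon the `∂_t R` term of the quotient rule and the `∂_r ν` terms both carry the
    -- factor `U + S = 0`.
    rw [h0, eq_neg_of_add_eq_zero_left h0]
    field
  have hre : partialD 1 C.Psi x = -(Real.exp (C.ψ (x 0) (x 1)) * (2 / 3 * C.μ (x 0) (x 1))) := by
    rw [hC.partialD_congr heq hx.1]
    refine ((((hasDerivAt_areaRate_radial hC hflat h).add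
      (hasDerivAt_areaSlope_radial hC hflat h)).const_mul 2).div hr.R_r hR).deriv.trans ?_
    simp only [Pi.add_apply]
    rw [h0, eq_neg_of_add_eq_zero_left h0]
    field
  simp [dirD, planeVec, Fin.sum_univ_four, u, e, ht, hre, Real.exp_neg]
  field

lemma innerG_planeVec (α β : ℝ) (x : Coord) :
    innerG C.metric x (C.planeVec α β x) (C.planeVec α β x) = β ^ 2 - α ^ 2 := by
  simp [innerG, planeVec, Fin.sum_univ_four, u, e, metric, Matrix.diagonal_apply, exp_two_mul,
    Real.exp_neg]
  field

end FluidCloud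
end

theorem mainTheorem3 (C : FluidCloud) (hC : C.IsContinuedCollapse)
    (hSEC : C.StrongEnergyCondition) (hflat : C.IsConformallyFlat) :
    (C.HorizonReachesCentralSingularity → C.EndStateIsBlackHole) ∧
    ∀ x ∈ C.apparentHorizon, C.Psi x = 0 ∧ 0 < C.μ (x 0) (x 1) + C.p (x 0) (x 1) ∧
      (∃ α β : ℝ, C.IsHorizonTangent α β x) ∧
      ∀ α β : ℝ, C.IsHorizonTangent α β x →
        α * ((1 / 3) * C.μ (x 0) (x 1) + C.p (x 0) (x 1))
          = β * (-(2 / 3) * C.μ (x 0) (x 1)) ∧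
        (β = 0 ↔ C.μ (x 0) (x 1) + 3 * C.p (x 0) (x 1) = 0) ∧
        (β ≠ 0 → α / β = (-(2 / 3) * C.μ (x 0) (x 1)) /
          ((1 / 3) * C.μ (x 0) (x 1) + C.p (x 0) (x 1))) ∧
        (1 ≤ α / β → C.μ (x 0) (x 1) + C.p (x 0) (x 1) ≤ 0) ∧
        ¬ 1 ≤ α / β ∧
        (β ≠ 0 → α / β < 0) ∧
        (∃ c > 0, innerG C.metric x (C.planeVec α β x) (C.planeVec α β x) =
          c * (-(1 / 3) * (C.μ (x 0) (x 1) + C.p (x 0) (x 1))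
            * (C.μ (x 0) (x 1) - 3 * C.p (x 0) (x 1)))) ∧
        (innerG C.metric x (C.planeVec α β x) (C.planeVec α β x) < 0 ↔
          3 * C.p (x 0) (x 1) < C.μ (x 0) (x 1)) ∧
        (innerG C.metric x (C.planeVec α β x) (C.planeVec α β x) = 0 ↔
          C.μ (x 0) (x 1) = 3 * C.p (x 0) (x 1)) ∧
        (0 < innerG C.metric x (C.planeVec α β x) (C.planeVec α β x) ↔
          C.μ (x 0) (x 1) < 3 * C.p (x 0) (x 1)) := by
  refine ⟨FluidCloud.endStateIsBlackHole hC hSEC hflat, fun x hx => ?_⟩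
  have hμ := FluidCloud.density_pos_of_horizon hC hflat hx
  have hsec := (hSEC _ _ hx.1.1).2
  have hPsi : C.Psi x = 0 := by
    rw [FluidCloud.Psi_eq (hC.isRegularAt_of_mem_region hx.1)
      (FluidCloud.sin_ne_zero_of_mem_region hx.1),
      FluidCloud.areaRate_add_areaSlope_eq_zero hC hx]
    simp
  have hdir := FluidCloud.dirD_Psi hC hflat hx
  have hinner := fun α β => FluidCloud.innerG_planeVec (C := C) α β x
  generalize C.μ (x 0) (x 1) = μ at *
  generalize C.p (x 0) (x 1) = p at *
  have hμp : 0 < μ + p := by linarith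
  -- The witness is the evident solution of the linear tangency equation, nonzero because `μ > 0`.
  refine ⟨hPsi, hμp, ⟨-(2 / 3) * μ, μ / 3 + p, Or.inl (by nlinarith), ?_⟩, fun α β hαβ => ?_⟩
  · rw [hdir]
    ring
  obtain ⟨hne, hd⟩ := hαβ
  rw [hdir] at hd
  rw [hinner]
  have heq : α * (1 / 3 * μ + p) = β * (-(2 / 3) * μ) := by linarith
  have hα : α ≠ 0 := by
    rintro rfl
    refine hne.elim (fun h => h rfl) fun hβ => hβ ?_
    have : β * μ = 0 := by linarith
    exact (mul_eq_zero.1 this).resolve_right hμ.ne'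
  have hβ0 : β = 0 ↔ μ + 3 * p = 0 := by
    constructor
    · rintro rfl
      have : α * (μ + 3 * p) = 0 := by linarith
      exact (mul_eq_zero.1 this).resolve_left hα
    · intro h
      have h1 : 1 / 3 * μ + p = 0 := by linarith
      rw [h1, mul_zero] at heq
      exact (mul_eq_zero.1 heq.symm).resolve_right (by linarith)
  have hpos : β ≠ 0 → 0 < 1 / 3 * μ + p := fun hβ => by
    have := hsec.lt_of_ne' (mt hβ0.2 hβ)
    linarith
  have hratio : β ≠ 0 → α / β = (-(2 / 3) * μ) / (1 / 3 * μ + p) := fun hβ => by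
    rw [div_eq_div_iff hβ (hpos hβ).ne', heq]
    ring
  have hneg : β ≠ 0 → α / β < 0 := fun hβ => by
    rw [hratio hβ]
    exact div_neg_of_neg_of_pos (by linarith) (hpos hβ)
  have hlt : ¬ 1 ≤ α / β := by
    by_cases hβ : β = 0
    -- Here `α / 0 = 0`, so the inequality fails by convention.
    · simp [hβ]
    · have := hneg hβ
      linarith
  -- The constant comes from solving tangency for `β`, dividing by `μ > 0`: unlike `β` and `μ/3 +
  -- p`, neither `α` nor `μ` can vanish.
  have hc : 0 < 9 * α ^ 2 / (4 * μ ^ 2) := by positivity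
  have hnorm : β ^ 2 - α ^ 2 =
      9 * α ^ 2 / (4 * μ ^ 2) * (-(1 / 3) * (μ + p) * (μ - 3 * p)) := by
    have hβ : β = -(3 * α * (1 / 3 * μ + p)) / (2 * μ) := by
      rw [eq_div_iff (by positivity)]
      linarith
    rw [hβ]
    field
  set c := 9 * α ^ 2 / (4 * μ ^ 2)
  have hk : 0 < c * (1 / 3 * (μ + p)) := by positivity
  have hnorm' : β ^ 2 - α ^ 2 = c * (1 / 3 * (μ + p)) * (3 * p - μ) := by
    rw [hnorm]
    ring
  refine ⟨heq, hβ0, hratio, fun h => absurd h hlt, hlt, hneg, ⟨c, hc, hnorm⟩, ?_, ?_, ?_⟩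
  · rw [hnorm', ← mul_zero (c * (1 / 3 * (μ + p))), mul_lt_mul_iff_right₀ hk, sub_neg]
  · rw [hnorm', mul_eq_zero, or_iff_right hk.ne', sub_eq_zero, eq_comm]
  · rw [hnorm', mul_pos_iff_of_pos_left hk, sub_pos]
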